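/- Let $\mathcal M=(\mathcal S,\mathcal A,\mathcal P,r,\gamma)$ be a finite Markov decision process: $\mathcal S$, $\mathcal A$ are finite, $\mathcal A\neq\emptyset$, $\mathcal P(\cdot\mid s,a)$ is a probability distribution on $\mathcal S$ for every $(s,a)$, $r:\mathcal S\times\mathcal A\to\mathbb R$, and $\gamma\in[0,1)$. Write $S=|\mathcal S|$. For a policy $\pi:\mathcal S\to\Delta(\mathcal A)$ and a distribution $\rho\in\Delta(\mathcal S)$ let $V^\pi(s)=\mathbb E\big[\sum_{t\ge0}\gamma^t r(s_t,a_t)\mid s_0=s\big]$ with $a_t\sim\pi(\cdot\mid s_t)$, $s_{t+1}\sim\mathcal P(\cdot\mid s_t,a_t)$; let $V^\pi(\rho)=\sum_s\rho(s)V^\pi(s)$, $Q^\pi(s,a)=r(s,a)+\gamma\sum_{s'}\mathcal P(s'\mid s,a)V^\pi(s')$, and $d^\pi_\rho(s)=\sum_{s_0}\rho(s_0)\,(1-\gamma)\sum_{t\ge0}\gamma^t\Pr(s_t=s\mid s_0,\pi,\mathcal P)$. For $\theta\in\mathbb R^{\mathcal S\times\mathcal A}$ let $\pi_\theta(a\mid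 s)=e^{\theta(s,a)}/\sum_{a'}e^{\theta(s,a')}$. Let $\mu,\rho\in\Delta(\mathcal S)$ with $\min_s\mu(s)>0$. Let $\pi^*$ be a deterministic optimal policy (its value is maximal among all policies, from every state), let $a^*(s)$ be the action that it selects in state $s$, and write $V^*=V^{\pi^*}$, $Q^*=Q^{\pi^*}$. Put $$C_\infty=\max_\pi\Big\|\frac{d^\pi_\mu}{\mu}\Big\|_\infty,\qquad C'_\infty=\max_\pi\Big\|\frac{d^\pi_\rho}{\mu}\Big\|_\infty,\qquad \eta=\frac{1-\gamma}{6(1-\gamma)+8\,(C_\infty-(1-\gamma))}\cdot\frac1{\sqrt S}.$$ Let $\theta_1\in\mathbb R^{\mathcal S\times\mathcal A}$ be arbitrary and, for $t\ge1$, $$\theta_{t+1}=\theta_t+\eta\cdot\frac{\partial V^{\pi_{\theta_t}}(\mu)}{\partial\theta_t}\Big/\Big\|\frac{\partial V^{\pi_{\theta_t}}(\mu)}{\partial\theta_t}\Big\|_2$$ (with $\theta_{t+1}=\theta_t$ if the gradient vanishes). Let $c=\inf_{s\in\mathcal S,\,t\ge1}\pi_{\theta_t}(a^*(s)\mid s)$.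 Then: (i) if the optimal action is unique in every state, that is, $Q^*(s,a)<Q^*(s,a^*(s))$ for all $s$ and all $a\ne a^*(s)$, then $c>0$; (ii) for all $t\ge1$, $$V^*(\rho)-V^{\pi_{\theta_t}}(\rho)\le\frac{\big(V^*(\mu)-V^{\pi_{\theta_1}}(\mu)\big)\cdot C'_\infty}{1-\gamma}\cdot e^{-C(t-1)},$$ where $$C=\frac{(1-\gamma)^2\,c}{12(1-\gamma)+16\,(C_\infty-(1-\gamma))}\cdot\frac1S\cdot\Big\|\frac{d^{\pi^*}_\mu}{\mu}\Big\|_\infty^{-1}.$$ -/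

import Mathlib

/-- A finite Markov decision process with state space `S` and action space `A`: transition
probabilities `P s a`, rewards `r s a`, and a discount factor `γ ∈ [0, 1)`. -/
structure FiniteMDP (S A : Type*) [Fintype S] where
  P : S → A → stdSimplex ℝ S
  r : S → A → ℝ
  γ : ℝ
  γ_nonneg : 0 ≤ γ
  γ_lt_one : γ < 1

namespace FiniteMDP

/-- A stationary stochastic policy: a probability distribution on actions for every state. -/
abbrev Policy (S A : Type*) [Fintype A] : Type _ := S → stdSimplex ℝ A

section Policies

/-- The policy that selects the action `b s` in state `s`. -/
def detPolicy {S A : Type*} [Fintype A] [DecidableEq A] (b : S → A) : Policy S A :=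
  fun s => ⟨Pi.single (b s) 1, single_mem_stdSimplex ℝ (b s)⟩

/-- The tabular softmax policy with parameter `θ`; the parameter space carries the
Euclidean norm. -/
noncomputable def softmaxPolicy {S A : Type*} [Fintype A] [Nonempty A]
    (θ : EuclideanSpace ℝ (S × A)) : Policy S A :=
  fun s => ⟨fun a => Real.exp (θ (s, a)) / ∑ a', Real.exp (θ (s, a')),
    fun a => by positivity,
    by
      rw [← Finset.sum_div]
      exact div_self (Finset.sum_pos (fun a _ => Real.exp_pos _) Finset.univ_nonempty).ne'⟩

end Policies

section Values

/-- The state-to-state transition matrix of the chain `s_{t+1} ∼ P(· | s_t, a_t)`,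
`a_t ∼ π(· | s_t)`. -/
noncomputable def transMatrix {S A : Type*} [Fintype S] [Fintype A]
    (M : FiniteMDP S A) (π : Policy S A) : Matrix S S ℝ :=
  Matrix.of fun s s' => ∑ a, (π s).1 a * (M.P s a).1 s'

/-- `stateProb M π t s₀ s` is the probability that `s_t = s` when the chain of `π` starts in
`s₀`. -/
noncomputable def stateProb {S A : Type*} [Fintype S] [Fintype A] [DecidableEq S]
    (M : FiniteMDP S A) (π : Policy S A) (t : ℕ) (s₀ s : S) : ℝ :=
  (M.transMatrix π ^ t) s₀ s

/-- The expected reward at time `t` when the chain of `π` starts in `s₀`. -/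
noncomputable def expReward {S A : Type*} [Fintype S] [Fintype A] [DecidableEq S]
    (M : FiniteMDP S A) (π : Policy S A) (t : ℕ) (s₀ : S) : ℝ :=
  ∑ s, ∑ a, M.stateProb π t s₀ s * (π s).1 a * M.r s a

/-- The state value `V^π(s)`, the expected discounted total reward from `s`. -/
noncomputable def value {S A : Type*} [Fintype S] [Fintype A] [DecidableEq S]
    (M : FiniteMDP S A) (π : Policy S A) (s : S) : ℝ :=
  ∑' t : ℕ, M.γ ^ t * M.expReward π t s

/-- `V^π(ρ) = E_{s ∼ ρ} V^π(s)`. -/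
noncomputable def valueAt {S A : Type*} [Fintype S] [Fintype A] [DecidableEq S]
    (M : FiniteMDP S A) (π : Policy S A) (ρ : stdSimplex ℝ S) : ℝ :=
  ∑ s, ρ.1 s * M.value π s

/-- The state-action value `Q^π(s, a)`. -/
noncomputable def qValue {S A : Type*} [Fintype S] [Fintype A] [DecidableEq S]
    (M : FiniteMDP S A) (π : Policy S A) (s : S) (a : A) : ℝ :=
  M.r s a + M.γ * ∑ s', (M.P s a).1 s' * M.value π s'

/-- The discounted state distribution `d_ρ^π(s)`. -/
noncomputable def stateDist {S A : Type*} [Fintype S] [Fintype A] [DecidableEq S]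
    (M : FiniteMDP S A) (π : Policy S A) (ρ : stdSimplex ℝ S) (s : S) : ℝ :=
  ∑ s₀, ρ.1 s₀ * ((1 - M.γ) * ∑' t : ℕ, M.γ ^ t * M.stateProb π t s₀ s)

/-- `π` is optimal: its value is maximal among all policies, from every state. -/
def IsOptimal {S A : Type*} [Fintype S] [Fintype A] [DecidableEq S]
    (M : FiniteMDP S A) (π : Policy S A) : Prop :=
  ∀ (π' : Policy S A) (s : S), M.value π' s ≤ M.value π s

/-- The mismatch coefficient `‖d_ρ^π / μ‖_∞` (the norm of `S → ℝ` is the maximum norm). -/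
noncomputable def mismatch {S A : Type*} [Fintype S] [Fintype A] [DecidableEq S]
    (M : FiniteMDP S A) (π : Policy S A) (ρ μ : stdSimplex ℝ S) : ℝ :=
  ‖fun s : S => M.stateDist π ρ s / μ.1 s‖

/-- The largest mismatch coefficient `max_π ‖d_ρ^π / μ‖_∞` over all policies. -/
noncomputable def maxMismatch {S A : Type*} [Fintype S] [Fintype A] [DecidableEq S]
    (M : FiniteMDP S A) (ρ μ : stdSimplex ℝ S) : ℝ :=
  ⨆ π : Policy S A, M.mismatch π ρ μ

end Values

section Algorithm

/-- The gradient of `θ ↦ V^{π_θ}(μ)`. -/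
noncomputable def policyGradient {S A : Type*} [Fintype S] [Fintype A] [DecidableEq S]
    [Nonempty A] (M : FiniteMDP S A) (μ : stdSimplex ℝ S) (θ : EuclideanSpace ℝ (S × A)) :
    EuclideanSpace ℝ (S × A) :=
  gradient (fun θ' : EuclideanSpace ℝ (S × A) => M.valueAt (softmaxPolicy θ') μ) θ

/-- `θ 1, θ 2, …` is generated by geometry-aware normalized policy gradient with learning
rate `η` (the parameter is left unchanged where the gradient vanishes). -/
def IsGNPG {S A : Type*} [Fintype S] [Fintype A] [DecidableEq S] [Nonempty A]
    (M : FiniteMDP S A) (μ : stdSimplex ℝ S) (η : ℝ) (θ : ℕ → EuclideanSpace ℝ (S × A)) :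
    Prop :=
  ∀ t : ℕ, 1 ≤ t →
    θ (t + 1) = θ t + (η / ‖M.policyGradient μ (θ t)‖) • M.policyGradient μ (θ t)

/-- The step size of the theorem, `(1-γ) / (6(1-γ) + 8(C_∞ - (1-γ))) · 1/√S`. -/
noncomputable def stepSize {S A : Type*} [Fintype S] [Fintype A] [DecidableEq S]
    (M : FiniteMDP S A) (μ : stdSimplex ℝ S) : ℝ :=
  (1 - M.γ) / (6 * (1 - M.γ) + 8 * (M.maxMismatch μ μ - (1 - M.γ)))
    * (1 / Real.sqrt (Fintype.card S))

/-- `inf_{s, t ≥ 1} π_{θ_t}(b(s) | s)`. -/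
noncomputable def infActionProb {S A : Type*} [Fintype A] [Nonempty A]
    (b : S → A) (θ : ℕ → EuclideanSpace ℝ (S × A)) : ℝ :=
  sInf {x : ℝ | ∃ (s : S) (t : ℕ), 1 ≤ t ∧ x = (softmaxPolicy (θ t) s).1 (b s)}

/-- The rate constant
`(1-γ)² c / (12(1-γ) + 16(C_∞ - (1-γ))) · 1/S · ‖d_μ^{π*} / μ‖_∞⁻¹`. -/
noncomputable def rate {S A : Type*} [Fintype S] [Fintype A] [DecidableEq S]
    (M : FiniteMDP S A) (μ : stdSimplex ℝ S) (πstar : Policy S A) (c : ℝ) : ℝ :=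
  (1 - M.γ) ^ 2 * c / (12 * (1 - M.γ) + 16 * (M.maxMismatch μ μ - (1 - M.γ)))
    * (1 / (Fintype.card S : ℝ)) * (M.mismatch πstar μ μ)⁻¹

end Algorithm

end FiniteMDP

/-! Rate. One normalized step changes each logit by at most `η`, so action probabilities change by a
factor of at most `exp (2 * η)`; by a perturbation bound for the balance equation
(`le_stateDist_of_le_mul`) the new state distribution then still dominates a fixed multiple of the
old one. The step also raises, in every state, the mean of the old advantage, by an amount
proportional to the squared gradient entries of that state. Inserting both into the performance
difference formula gives an ascent of at least `η / 2` times the gradient norm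
(`valueAt_normalized_step_ge`), with no bound on second derivatives. The inequality `lojasiewicz`
bounds this norm below by a multiple of the optimality gap, so the gap contracts geometrically under
`μ`; `IsOptimal.valueAt_gap_le` transfers it to `ρ`. This holds for any `c ≥ 0`.

Positivity of `c`. Values increase in every state and are bounded, so values and advantages
converge; by the ascent bound the gradient tends to zero. The crux, `limit_advantage_nonpos`,
excludes a positive limiting advantage, so the limit dominates its one-step lookahead and is
optimal. If optimal actions are unique, suboptimal actions have nonzero limiting advantage, hence
their probabilities vanish and that of the optimal action tends to one. -/

namespace FiniteMDP

/-! ### Discounted occupancy as the inverse of `1 - γ P` -/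

section Occupancy

variable {S A : Type*} [Fintype S] (M : FiniteMDP S A)

lemma one_sub_γ_pos : 0 < 1 - M.γ := sub_pos.2 M.γ_lt_one

variable [Fintype A]

lemma transMatrix_nonneg (π : Policy S A) (s s' : S) : 0 ≤ M.transMatrix π s s' :=
  Finset.sum_nonneg fun a _ => mul_nonneg ((π s).2.1 a) ((M.P s a).2.1 s')

lemma transMatrix_row_sum (π : Policy S A) (s : S) : ∑ s', M.transMatrix π s s' = 1 := by
  simp only [transMatrix, Matrix.of_apply]
  rw [Finset.sum_comm]
  simp_rw [← Finset.mul_sum, (M.P s _).2.2, mul_one]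
  exact (π s).2.2

lemma sum_transMatrix_mul (π : Policy S A) (s : S) (f : S → ℝ) :
    ∑ s', M.transMatrix π s s' * f s' = ∑ a, (π s).1 a * ∑ s', (M.P s a).1 s' * f s' := by
  simp only [transMatrix, Matrix.of_apply, Finset.sum_mul, Finset.mul_sum, mul_assoc]
  exact Finset.sum_comm

variable [DecidableEq S]

lemma stateProb_nonneg (π : Policy S A) (t : ℕ) (s s' : S) : 0 ≤ M.stateProb π t s s' := by
  induction t generalizing s' with
  | zero => simp only [stateProb, pow_zero, Matrix.one_apply]; split_ifs <;> norm_num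
  | succ t ih =>
    simp only [stateProb, pow_succ, Matrix.mul_apply]
    exact Finset.sum_nonneg fun x _ => mul_nonneg (ih x) (M.transMatrix_nonneg π x s')

lemma stateProb_row_sum (π : Policy S A) (t : ℕ) (s : S) : ∑ s', M.stateProb π t s s' = 1 := by
  induction t with
  | zero => simp [stateProb, Matrix.one_apply]
  | succ t ih =>
    simp only [stateProb, pow_succ, Matrix.mul_apply] at ih ⊢
    rw [Finset.sum_comm]
    simp_rw [← Finset.mul_sum, M.transMatrix_row_sum, mul_one]
    exact ih

lemma stateProb_le_one (π : Policy S A) (t : ℕ) (s s' : S) : M.stateProb π t s s' ≤ 1 :=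
  (Finset.single_le_sum (fun x _ => M.stateProb_nonneg π t s x) (Finset.mem_univ s')).trans_eq
    (M.stateProb_row_sum π t s)

lemma summable_stateProb (π : Policy S A) (s s' : S) :
    Summable fun t : ℕ => M.γ ^ t * M.stateProb π t s s' :=
  Summable.of_nonneg_of_le
    (fun t => mul_nonneg (pow_nonneg M.γ_nonneg t) (M.stateProb_nonneg π t s s'))
    (fun t => mul_le_of_le_one_right (pow_nonneg M.γ_nonneg t) (M.stateProb_le_one π t s s'))
    (summable_geometric_of_lt_one M.γ_nonneg M.γ_lt_one)

/-- The expected discounted number of visits, `∑ γ^t Pr(s_t = s' | s_0 = s)`. -/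
noncomputable def occupancy (π : Policy S A) : Matrix S S ℝ :=
  Matrix.of fun s s' => ∑' t : ℕ, M.γ ^ t * M.stateProb π t s s'

lemma occupancy_nonneg (π : Policy S A) (s s' : S) : 0 ≤ M.occupancy π s s' :=
  tsum_nonneg fun t => mul_nonneg (pow_nonneg M.γ_nonneg t) (M.stateProb_nonneg π t s s')

lemma occupancy_eq (π : Policy S A) :
    M.occupancy π = 1 + M.occupancy π * (M.γ • M.transMatrix π) := by
  ext s s'
  simp only [occupancy, Matrix.add_apply, Matrix.mul_apply, Matrix.smul_apply, Matrix.of_apply,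
    smul_eq_mul]
  rw [(M.summable_stateProb π s s').tsum_eq_zero_add]
  congr 1
  · simp [stateProb]
  · simp_rw [← tsum_mul_right]
    rw [← Summable.tsum_finsetSum fun x _ => (M.summable_stateProb π s x).mul_right _]
    refine tsum_congr fun t => ?_
    simp only [stateProb, pow_succ, Matrix.mul_apply, Finset.mul_sum]
    exact Finset.sum_congr rfl fun x _ => by ring

lemma occupancy_mul (π : Policy S A) : M.occupancy π * (1 - M.γ • M.transMatrix π) = 1 := by
  rw [mul_sub, mul_one, sub_eq_iff_eq_add]
  exact M.occupancy_eq π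

lemma mul_occupancy (π : Policy S A) : (1 - M.γ • M.transMatrix π) * M.occupancy π = 1 :=
  mul_eq_one_comm.1 (M.occupancy_mul π)

/-- Recovers a function from its Bellman residual. Since the occupancy is nonnegative, pointwise
bounds on the residual become bounds on the function; `eq_vecMul_occupancy` plays the same role for
the balance equation. -/
lemma eq_occupancy_mulVec (π : Policy S A) (f : S → ℝ) (s : S) :
    f s = ∑ x, M.occupancy π s x * (f x - M.γ * ∑ y, M.transMatrix π x y * f y) := by
  have h : (M.occupancy π * (1 - M.γ • M.transMatrix π)).mulVec f = f := by
    rw [M.occupancy_mul, Matrix.one_mulVec]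
  conv_lhs => rw [← h, ← Matrix.mulVec_mulVec, Matrix.sub_mulVec, Matrix.one_mulVec,
    Matrix.smul_mulVec]
  simp [Matrix.mulVec, dotProduct]

lemma eq_vecMul_occupancy (π : Policy S A) (f : S → ℝ) (s : S) :
    f s = ∑ x, (f x - M.γ * ∑ y, f y * M.transMatrix π y x) * M.occupancy π x s := by
  have h : Matrix.vecMul f ((1 - M.γ • M.transMatrix π) * M.occupancy π) = f := by
    rw [M.mul_occupancy, Matrix.vecMul_one]
  conv_lhs => rw [← h, ← Matrix.vecMul_vecMul, Matrix.vecMul_sub, Matrix.vecMul_one,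
    Matrix.vecMul_smul]
  simp [Matrix.vecMul, dotProduct]

lemma stateDist_eq (π : Policy S A) (ρ : stdSimplex ℝ S) (s : S) :
    M.stateDist π ρ s = (1 - M.γ) * ∑ x, ρ.1 x * M.occupancy π x s := by
  simp only [stateDist, occupancy, Matrix.of_apply, Finset.mul_sum]
  exact Finset.sum_congr rfl fun x _ => by ring

lemma stateDist_nonneg (π : Policy S A) (ρ : stdSimplex ℝ S) (s : S) : 0 ≤ M.stateDist π ρ s := by
  rw [stateDist_eq]
  exact mul_nonneg M.one_sub_γ_pos.le
    (Finset.sum_nonneg fun x _ => mul_nonneg (ρ.2.1 x) (M.occupancy_nonneg π x s))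

lemma stateDist_balance (π : Policy S A) (ρ : stdSimplex ℝ S) (s : S) :
    M.stateDist π ρ s
      = (1 - M.γ) * ρ.1 s + M.γ * ∑ x, M.stateDist π ρ x * M.transMatrix π x s := by
  have h : Matrix.vecMul ρ.1 (M.occupancy π) s
      = ρ.1 s + Matrix.vecMul (Matrix.vecMul ρ.1 (M.occupancy π)) (M.γ • M.transMatrix π) s := by
    conv_lhs => rw [M.occupancy_eq π, Matrix.vecMul_add, Matrix.vecMul_one,
      ← Matrix.vecMul_vecMul, Pi.add_apply]
  simp only [stateDist_eq]
  have e : ∀ x, ∑ y, ρ.1 y * M.occupancy π y x = Matrix.vecMul ρ.1 (M.occupancy π) x :=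
    fun x => rfl
  simp only [e]
  conv_lhs => rw [h]
  rw [Matrix.vecMul_smul]
  simp only [Pi.smul_apply, smul_eq_mul, mul_add, mul_assoc, ← Finset.mul_sum]
  rw [mul_left_comm]
  rfl

lemma le_stateDist (π : Policy S A) (ρ : stdSimplex ℝ S) (s : S) :
    (1 - M.γ) * ρ.1 s ≤ M.stateDist π ρ s := by
  rw [M.stateDist_balance π ρ s, le_add_iff_nonneg_right]
  exact mul_nonneg M.γ_nonneg (Finset.sum_nonneg fun x _ =>
    mul_nonneg (M.stateDist_nonneg π ρ x) (M.transMatrix_nonneg π x s))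

lemma stateDist_sum (π : Policy S A) (ρ : stdSimplex ℝ S) : ∑ s, M.stateDist π ρ s = 1 := by
  have h : ∑ s, M.stateDist π ρ s = (1 - M.γ) + M.γ * ∑ s, M.stateDist π ρ s := by
    conv_lhs => rw [Finset.sum_congr rfl fun s _ => M.stateDist_balance π ρ s]
    rw [Finset.sum_add_distrib, ← Finset.mul_sum, ρ.2.2, ← Finset.mul_sum, Finset.sum_comm]
    simp_rw [← Finset.mul_sum, M.transMatrix_row_sum, mul_one]
  have := M.one_sub_γ_pos
  nlinarith

lemma stateDist_le_one (π : Policy S A) (ρ : stdSimplex ℝ S) (s : S) : M.stateDist π ρ s ≤ 1 :=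
  (Finset.single_le_sum (fun x _ => M.stateDist_nonneg π ρ x) (Finset.mem_univ s)).trans_eq
    (M.stateDist_sum π ρ)

end Occupancy

/-! ### Mismatch coefficients and perturbation of the state distribution -/

section Mismatch

variable {S A : Type*} [Fintype S] [Fintype A] [DecidableEq S] (M : FiniteMDP S A)
  {μ : stdSimplex ℝ S}

lemma stateDist_le_mismatch (hμ : ∀ s, 0 < μ.1 s) (π : Policy S A) (ρ : stdSimplex ℝ S) (s : S) :
    M.stateDist π ρ s ≤ M.mismatch π ρ μ * μ.1 s := by
  rw [← div_le_iff₀ (hμ s)]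
  exact (le_abs_self _).trans (norm_le_pi_norm (fun s => M.stateDist π ρ s / μ.1 s) s)

lemma bddAbove_mismatch (hμ : ∀ s, 0 < μ.1 s) (ρ : stdSimplex ℝ S) :
    BddAbove (Set.range fun π : Policy S A => M.mismatch π ρ μ) := by
  refine ⟨∑ s, 1 / μ.1 s, ?_⟩
  rintro _ ⟨π, rfl⟩
  have h0 : ∀ s, 0 ≤ 1 / μ.1 s := fun s => (one_div_pos.2 (hμ s)).le
  refine (pi_norm_le_iff_of_nonneg (Finset.sum_nonneg fun s _ => h0 s)).2 fun s => ?_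
  rw [Real.norm_of_nonneg (div_nonneg (M.stateDist_nonneg π ρ s) (hμ s).le)]
  exact (div_le_div_of_nonneg_right (M.stateDist_le_one π ρ s) (hμ s).le).trans
    (Finset.single_le_sum (f := fun s => 1 / μ.1 s) (fun s _ => h0 s) (Finset.mem_univ s))

lemma stateDist_le_maxMismatch (hμ : ∀ s, 0 < μ.1 s) (π : Policy S A) (ρ : stdSimplex ℝ S)
    (s : S) : M.stateDist π ρ s ≤ M.maxMismatch ρ μ * μ.1 s :=
  (M.stateDist_le_mismatch hμ π ρ s).trans
    (mul_le_mul_of_nonneg_right (le_ciSup (M.bddAbove_mismatch hμ ρ) π) (hμ s).le)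

lemma one_sub_γ_le_mismatch (hμ : ∀ s, 0 < μ.1 s) (π : Policy S A) :
    1 - M.γ ≤ M.mismatch π μ μ := by
  obtain ⟨s⟩ : Nonempty S := by
    by_contra h
    rw [not_nonempty_iff] at h
    simpa using μ.2.2
  exact le_of_mul_le_mul_right ((M.le_stateDist π μ s).trans (M.stateDist_le_mismatch hμ π μ s))
    (hμ s)

lemma one_sub_γ_le_maxMismatch (hμ : ∀ s, 0 < μ.1 s) (π : Policy S A) :
    1 - M.γ ≤ M.maxMismatch μ μ :=
  (M.one_sub_γ_le_mismatch hμ π).trans (le_ciSup (M.bddAbove_mismatch hμ μ) π)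

/-- The difference of the two distributions satisfies the balance equation of `π` up to a residual.
As the transitions of `π` are at most `E` times those of `π'`, the residual is at least `-(E - 1)`
times `stateDist π' μ - (1 - γ) μ`, and `stateDist π' μ` is at most the maximal mismatch times `μ`.
Applying the occupancy of `π` to this multiple of `μ` gives back a multiple of `stateDist π μ`. -/
lemma le_stateDist_of_le_mul (hμ : ∀ s, 0 < μ.1 s) (π π' : Policy S A) {E : ℝ} (hE : 1 ≤ E)
    (h : ∀ s a, (π s).1 a ≤ E * (π' s).1 a) (x : S) :
    (1 - (E - 1) * ((M.maxMismatch μ μ - (1 - M.γ)) / (1 - M.γ))) * M.stateDist π μ x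
      ≤ M.stateDist π' μ x := by
  have hγ := M.one_sub_γ_pos
  have hP : ∀ z s, M.transMatrix π z s ≤ E * M.transMatrix π' z s := fun z s => by
    simp only [transMatrix, Matrix.of_apply, Finset.mul_sum, ← mul_assoc]
    exact Finset.sum_le_sum fun a _ => mul_le_mul_of_nonneg_right (h z a) ((M.P z a).2.1 s)
  have key : ∀ s, -((E - 1) * (M.maxMismatch μ μ - (1 - M.γ)) * μ.1 s) ≤
      (M.stateDist π' μ s - M.stateDist π μ s) -
        M.γ * ∑ z, (M.stateDist π' μ z - M.stateDist π μ z) * M.transMatrix π z s := fun s => by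
    have h1 := M.stateDist_balance π μ s
    have h2 := M.stateDist_balance π' μ s
    have h3 : M.γ * ∑ z, M.stateDist π' μ z * M.transMatrix π z s ≤
        E * (M.γ * ∑ z, M.stateDist π' μ z * M.transMatrix π' z s) := by
      rw [mul_left_comm, Finset.mul_sum (a := E)]
      refine mul_le_mul_of_nonneg_left (Finset.sum_le_sum fun z _ => ?_) M.γ_nonneg
      rw [mul_left_comm]
      exact mul_le_mul_of_nonneg_left (hP z s) (M.stateDist_nonneg π' μ z)
    have h4 : (E - 1) * M.stateDist π' μ s ≤ (E - 1) * (M.maxMismatch μ μ * μ.1 s) :=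
      mul_le_mul_of_nonneg_left (M.stateDist_le_maxMismatch hμ π' μ s) (by linarith)
    simp only [sub_mul, Finset.sum_sub_distrib, mul_sub] at h4 ⊢
    nlinarith
  have h5 := M.eq_vecMul_occupancy π (fun s => M.stateDist π' μ s - M.stateDist π μ s) x
  have h6 := Finset.sum_le_sum fun s (_ : s ∈ Finset.univ) =>
    mul_le_mul_of_nonneg_right (key s) (M.occupancy_nonneg π s x)
  have h7 : ∑ s, -((E - 1) * (M.maxMismatch μ μ - (1 - M.γ)) * μ.1 s) * M.occupancy π s x
      = -((E - 1) * ((M.maxMismatch μ μ - (1 - M.γ)) / (1 - M.γ)) * M.stateDist π μ x) := by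
    rw [stateDist_eq, show (E - 1) * ((M.maxMismatch μ μ - (1 - M.γ)) / (1 - M.γ)) *
      ((1 - M.γ) * ∑ y, μ.1 y * M.occupancy π y x) = (E - 1) * (M.maxMismatch μ μ - (1 - M.γ)) *
      ∑ y, μ.1 y * M.occupancy π y x by field_simp, Finset.mul_sum, ← Finset.sum_neg_distrib]
    exact Finset.sum_congr rfl fun s _ => by ring
  rw [h7] at h6
  linarith

end Mismatch

/-! ### Bellman equation and performance difference -/

section PerformanceDifference

variable {S A : Type*} [Fintype S] [Fintype A] [DecidableEq S] (M : FiniteMDP S A)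

lemma value_eq (π : Policy S A) (s : S) :
    M.value π s = ∑ x, M.occupancy π s x * ∑ a, (π x).1 a * M.r x a := by
  simp only [value, occupancy, Matrix.of_apply, ← tsum_mul_right]
  rw [← Summable.tsum_finsetSum fun x _ => (M.summable_stateProb π s x).mul_right _]
  refine tsum_congr fun t => ?_
  simp only [expReward, Finset.mul_sum]
  exact Finset.sum_congr rfl fun x _ => Finset.sum_congr rfl fun a _ => by ring

lemma sum_mul_qValue (π π' : Policy S A) (s : S) :
    ∑ a, (π' s).1 a * M.qValue π s a
      = ∑ a, (π' s).1 a * M.r s a + M.γ * ∑ s', M.transMatrix π' s s' * M.value π s' := by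
  rw [sum_transMatrix_mul]
  simp only [qValue, mul_add, Finset.sum_add_distrib, Finset.mul_sum]
  congr 1
  exact Finset.sum_congr rfl fun a _ => Finset.sum_congr rfl fun s' _ => by ring

lemma value_bellman (π : Policy S A) (s : S) :
    M.value π s = ∑ a, (π s).1 a * M.qValue π s a := by
  rw [sum_mul_qValue]
  have h : M.value π = (M.occupancy π).mulVec fun x => ∑ a, (π x).1 a * M.r x a :=
    funext (M.value_eq π)
  have h1 : ((1 - M.γ • M.transMatrix π).mulVec (M.value π)) s = ∑ a, (π s).1 a * M.r s a := by
    rw [h, Matrix.mulVec_mulVec, M.mul_occupancy, Matrix.one_mulVec]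
  rw [Matrix.sub_mulVec, Matrix.one_mulVec, Matrix.smul_mulVec] at h1
  simp only [Pi.sub_apply, Pi.smul_apply, smul_eq_mul, Matrix.mulVec, dotProduct] at h1
  linarith

/-- The advantage `A^π(s, a) = Q^π(s, a) - V^π(s)`. -/
noncomputable def advantage (π : Policy S A) (s : S) (a : A) : ℝ :=
  M.qValue π s a - M.value π s

lemma sum_mul_advantage (π π' : Policy S A) (s : S) :
    ∑ a, (π' s).1 a * M.advantage π s a = ∑ a, (π' s).1 a * M.qValue π s a - M.value π s := by
  have h := (π' s).2.2
  simp only [advantage, mul_sub, Finset.sum_sub_distrib, ← Finset.sum_mul]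
  rw [h, one_mul]

lemma sum_mul_advantage_self (π : Policy S A) (s : S) :
    ∑ a, (π s).1 a * M.advantage π s a = 0 := by
  rw [sum_mul_advantage, ← value_bellman, sub_self]

/-- Under `π'`, the Bellman residual of the difference of values is the mean under `π'` of the
advantage of `π`; the occupancy of `π'` inverts it. -/
lemma value_sub_value (π π' : Policy S A) (s : S) :
    M.value π' s - M.value π s
      = ∑ x, M.occupancy π' s x * ∑ a, (π' x).1 a * M.advantage π x a := by
  rw [M.eq_occupancy_mulVec π' (fun s => M.value π' s - M.value π s) s]
  refine Finset.sum_congr rfl fun x _ => ?_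
  rw [sum_mul_advantage, sum_mul_qValue]
  have h := M.value_bellman π' x
  rw [sum_mul_qValue] at h
  simp only [mul_sub, Finset.sum_sub_distrib]
  rw [h]
  ring

lemma valueAt_sub_valueAt (π π' : Policy S A) (ρ : stdSimplex ℝ S) :
    M.valueAt π' ρ - M.valueAt π ρ
      = 1 / (1 - M.γ) * ∑ x, M.stateDist π' ρ x * ∑ a, (π' x).1 a * M.advantage π x a := by
  have hγ := M.one_sub_γ_pos.ne'
  simp only [valueAt, ← Finset.sum_sub_distrib, ← mul_sub, value_sub_value, stateDist_eq,
    mul_assoc (1 - M.γ), ← Finset.mul_sum]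
  rw [← mul_assoc, one_div, inv_mul_cancel₀ hγ, one_mul]
  simp only [Finset.sum_mul]
  rw [Finset.sum_comm]
  refine Finset.sum_congr rfl fun x _ => ?_
  rw [Finset.mul_sum]
  exact Finset.sum_congr rfl fun y _ => by ring

lemma value_le_value (π π' : Policy S A)
    (h : ∀ x, 0 ≤ ∑ a, (π' x).1 a * M.advantage π x a) (s : S) : M.value π s ≤ M.value π' s := by
  rw [← sub_nonneg, value_sub_value]
  exact Finset.sum_nonneg fun x _ => mul_nonneg (M.occupancy_nonneg π' s x) (h x)

end PerformanceDifference

end FiniteMDP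

/-! ### The softmax policy gradient -/

/-- Where the differentiable factor vanishes, the other one need only be continuous. This yields the
policy gradient without differentiating the state distribution. -/
lemma HasFDerivAt.mul_of_eq_zero {E : Type*} [NormedAddCommGroup E] [NormedSpace ℝ E]
    {f g : E → ℝ} {f' : E →L[ℝ] ℝ} {x : E} (hf : HasFDerivAt f f' x) (h0 : f x = 0)
    (hg : ContinuousAt g x) : HasFDerivAt (fun y => g y * f y) (g x • f') x := by
  have h1 : (fun y => f y - f x - f' (y - x)) =o[nhds x] fun y => y - x := hf.isLittleO
  have h2 : (fun y => g y - g x) =o[nhds x] fun _ => (1 : ℝ) := by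
    rw [Asymptotics.isLittleO_one_iff, ← sub_self (g x)]
    exact hg.sub continuousAt_const
  have h3 : (fun y => g y * (f y - f x - f' (y - x))) =o[nhds x] fun y => y - x := by
    have := (hg.tendsto.isBigO_one ℝ).mul_isLittleO h1.norm_right
    simpa using this
  have h4 : (fun y => (g y - g x) * f' (y - x)) =o[nhds x] fun y => y - x := by
    have := h2.mul_isBigO (f'.isBigO_sub (nhds x) x).norm_right
    simpa using this
  refine HasFDerivAt.of_isLittleO ((h3.add h4).congr_left fun y => ?_)
  simp only [h0, _root_.smul_apply, smul_eq_mul]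
  ring

namespace FiniteMDP

section PolicyGradient

variable {S A : Type*} [Fintype A]

lemma continuous_sum_exp (s : S) :
    Continuous fun θ : EuclideanSpace ℝ (S × A) => ∑ a, Real.exp (θ (s, a)) := by
  fun_prop

variable [Nonempty A]

lemma sum_exp_pos (θ : EuclideanSpace ℝ (S × A)) (s : S) : 0 < ∑ a, Real.exp (θ (s, a)) :=
  Finset.sum_pos (fun _ _ => Real.exp_pos _) Finset.univ_nonempty

lemma softmaxPolicy_apply (θ : EuclideanSpace ℝ (S × A)) (s : S) (a : A) :
    (softmaxPolicy θ s).1 a = Real.exp (θ (s, a)) / ∑ a', Real.exp (θ (s, a')) := rfl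

lemma softmaxPolicy_pos (θ : EuclideanSpace ℝ (S × A)) (s : S) (a : A) :
    0 < (softmaxPolicy θ s).1 a :=
  div_pos (Real.exp_pos _) (sum_exp_pos θ s)

lemma continuous_softmaxPolicy (s : S) (a : A) :
    Continuous fun θ : EuclideanSpace ℝ (S × A) => (softmaxPolicy θ s).1 a := by
  simp only [softmaxPolicy_apply]
  exact (by fun_prop : Continuous fun θ : EuclideanSpace ℝ (S × A) => Real.exp (θ (s, a))).div
    (continuous_sum_exp s) fun θ => (sum_exp_pos θ s).ne'

variable [Fintype S] [DecidableEq S] (M : FiniteMDP S A)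

lemma continuous_stateDist (ρ : stdSimplex ℝ S) (s : S) :
    Continuous fun θ : EuclideanSpace ℝ (S × A) => M.stateDist (softmaxPolicy θ) ρ s := by
  have hP : Continuous fun θ : EuclideanSpace ℝ (S × A) => M.transMatrix (softmaxPolicy θ) := by
    refine continuous_matrix fun x y => ?_
    simp only [transMatrix, Matrix.of_apply]
    exact continuous_finsetSum _ fun a _ => (continuous_softmaxPolicy x a).mul_const _
  refine continuous_finsetSum _ fun x _ => continuous_const.mul (continuous_const.mul ?_)
  refine continuous_tsum (fun t => continuous_const.mul ?_)
    (summable_geometric_of_lt_one M.γ_nonneg M.γ_lt_one) fun t θ => ?_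
  · exact (hP.pow t).matrix_elem x s
  · rw [Real.norm_of_nonneg (mul_nonneg (pow_nonneg M.γ_nonneg t) (M.stateProb_nonneg _ t x s))]
    exact mul_le_of_le_one_right (pow_nonneg M.γ_nonneg t) (M.stateProb_le_one _ t x s)

/-- The policy gradient theorem for the tabular softmax parametrization. -/
lemma policyGradient_apply (μ : stdSimplex ℝ S) (θ : EuclideanSpace ℝ (S × A)) (s : S) (a : A) :
    M.policyGradient μ θ (s, a) = 1 / (1 - M.γ) * M.stateDist (softmaxPolicy θ) μ s
      * ((softmaxPolicy θ s).1 a * M.advantage (softmaxPolicy θ) s a) := by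
  set π := softmaxPolicy θ with hπ
  let g : EuclideanSpace ℝ (S × A) := WithLp.toLp 2 fun i =>
    1 / (1 - M.γ) * M.stateDist π μ i.1 * ((π i.1).1 i.2 * M.advantage π i.1 i.2)
  suffices h : HasGradientAt
      (fun θ' : EuclideanSpace ℝ (S × A) => M.valueAt (softmaxPolicy θ') μ) g θ by
    rw [policyGradient, h.gradient]
  -- By performance difference, `valueAt` at `θ'` minus its value at `θ` is a sum of weights `w`
  -- times unnormalized mean advantages `N`. Each `N x` vanishes at `θ`, so only continuity of the
  -- weights matters.
  let N : S → EuclideanSpace ℝ (S × A) → ℝ := fun x θ' =>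
    ∑ a, Real.exp (θ' (x, a)) * M.advantage π x a
  let N' : S → EuclideanSpace ℝ (S × A) →L[ℝ] ℝ := fun x =>
    ∑ a, M.advantage π x a • Real.exp (θ (x, a)) • EuclideanSpace.proj (x, a)
  have hN : ∀ x, HasFDerivAt (N x) (N' x) θ := fun x =>
    HasFDerivAt.fun_sum fun a _ => HasFDerivAt.mul_const
      ((EuclideanSpace.proj (𝕜 := ℝ) (x, a)).hasFDerivAt (x := θ)).exp _
  have hsum : ∀ x (θ' : EuclideanSpace ℝ (S × A)),
      ∑ a, (softmaxPolicy θ' x).1 a * M.advantage π x a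
        = (∑ a', Real.exp (θ' (x, a')))⁻¹ * N x θ' := fun x θ' => by
    simp only [N, softmaxPolicy_apply, Finset.mul_sum]
    exact Finset.sum_congr rfl fun a _ => by ring
  have hN0 : ∀ x, N x θ = 0 := fun x => by
    have h := hsum x θ
    rw [← hπ, sum_mul_advantage_self] at h
    exact (mul_eq_zero.1 h.symm).resolve_left (inv_ne_zero (sum_exp_pos θ x).ne')
  let w : S → EuclideanSpace ℝ (S × A) → ℝ := fun x θ' =>
    1 / (1 - M.γ) * M.stateDist (softmaxPolicy θ') μ x * (∑ a', Real.exp (θ' (x, a')))⁻¹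
  have hw : ∀ x, ContinuousAt (w x) θ := fun x =>
    ((continuous_const.mul (M.continuous_stateDist μ x)).mul
      ((continuous_sum_exp x).inv₀ fun θ' => (sum_exp_pos θ' x).ne')).continuousAt
  have hV : (fun θ' : EuclideanSpace ℝ (S × A) => M.valueAt (softmaxPolicy θ') μ)
      = fun θ' => ∑ x, w x θ' * N x θ' + M.valueAt π μ := by
    funext θ'
    rw [← sub_eq_iff_eq_add, valueAt_sub_valueAt, Finset.mul_sum]
    refine Finset.sum_congr rfl fun x _ => ?_
    rw [hsum]
    simp only [w]
    ring
  rw [hasGradientAt_iff_hasFDerivAt, hV]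
  have hD : HasFDerivAt (fun θ' => ∑ x, w x θ' * N x θ' + M.valueAt π μ)
      (∑ x, w x θ • N' x) θ :=
    (HasFDerivAt.fun_sum fun x _ => (hN x).mul_of_eq_zero (hN0 x) (hw x)).add_const _
  refine hD.congr_fderiv (ContinuousLinearMap.ext fun v => ?_)
  simp only [InnerProductSpace.toDual_apply_apply, PiLp.inner_apply, Fintype.sum_prod_type, g, w,
    N', _root_.sum_apply, _root_.smul_apply, smul_eq_mul, EuclideanSpace.coe_proj,
    Finset.mul_sum]
  refine Finset.sum_congr rfl fun x _ => Finset.sum_congr rfl fun a _ => ?_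
  simp only [← hπ, RCLike.inner_apply, conj_trivial]
  rw [hπ, softmaxPolicy_apply, ← hπ]
  ring

end PolicyGradient

/-! ### Effect of a bounded logit change on a softmax policy -/

section SoftmaxUpdate

variable {S A : Type*} [Fintype A] [Nonempty A]

lemma softmaxPolicy_add (θ z : EuclideanSpace ℝ (S × A)) (s : S) (a : A) :
    (softmaxPolicy (θ + z) s).1 a = (softmaxPolicy θ s).1 a * Real.exp (z (s, a))
      / ∑ b, (softmaxPolicy θ s).1 b * Real.exp (z (s, b)) := by
  have h := (sum_exp_pos θ s).ne'
  simp only [softmaxPolicy_apply, PiLp.add_apply, Real.exp_add, div_mul_eq_mul_div,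
    ← Finset.sum_div]
  rw [div_div_div_cancel_right₀ h]

lemma sum_softmaxPolicy_mul_exp_pos (θ z : EuclideanSpace ℝ (S × A)) (s : S) :
    0 < ∑ b, (softmaxPolicy θ s).1 b * Real.exp (z (s, b)) :=
  Finset.sum_pos (fun b _ => mul_pos (softmaxPolicy_pos θ s b) (Real.exp_pos _))
    Finset.univ_nonempty

lemma sum_softmaxPolicy_mul_exp_le (θ z : EuclideanSpace ℝ (S × A)) {η : ℝ}
    (hz : ∀ s a, |z (s, a)| ≤ η) (s : S) :
    ∑ b, (softmaxPolicy θ s).1 b * Real.exp (z (s, b)) ≤ Real.exp η := by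
  calc _ ≤ ∑ b, (softmaxPolicy θ s).1 b * Real.exp η := Finset.sum_le_sum fun b _ =>
        mul_le_mul_of_nonneg_left (Real.exp_le_exp.2 ((le_abs_self _).trans (hz s b)))
          (softmaxPolicy_pos θ s b).le
    _ = Real.exp η := by rw [← Finset.sum_mul, (softmaxPolicy θ s).2.2, one_mul]

lemma softmaxPolicy_le_exp_mul (θ z : EuclideanSpace ℝ (S × A)) {η : ℝ}
    (hz : ∀ s a, |z (s, a)| ≤ η) (s : S) (a : A) :
    (softmaxPolicy θ s).1 a ≤ Real.exp (2 * η) * (softmaxPolicy (θ + z) s).1 a := by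
  have hZ := sum_softmaxPolicy_mul_exp_pos θ z s
  rw [softmaxPolicy_add, ← mul_div_assoc, le_div_iff₀ hZ, mul_left_comm]
  refine mul_le_mul_of_nonneg_left ((sum_softmaxPolicy_mul_exp_le θ z hz s).trans ?_)
    (softmaxPolicy_pos θ s a).le
  rw [← Real.exp_add]
  exact Real.exp_le_exp.2 (by linarith [neg_abs_le (z (s, a)), hz s a])

/-- For `z ≥ 0` use `exp z - 1 ≥ z`; for `z ≤ 0` use `exp z - 1 ≤ z * exp z` and `exp z ≥ exp (-η)`.
-/
lemma mul_exp_sub_one_ge {z η : ℝ} (hz : |z| ≤ η) :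
    Real.exp (-η) * z ^ 2 ≤ z * (Real.exp z - 1) := by
  have hη : 0 ≤ η := (abs_nonneg z).trans hz
  rcases le_total 0 z with h | h
  · have h1 : Real.exp (-η) ≤ 1 := Real.exp_le_one_iff.2 (by linarith)
    have h2 := Real.add_one_le_exp z
    nlinarith [sq_nonneg z, mul_nonneg h (sub_nonneg.2 h2)]
  · have h1 : Real.exp (-η) ≤ Real.exp z := Real.exp_le_exp.2 (by linarith [neg_abs_le z])
    have h2 := Real.add_one_le_exp (-z)
    have h3 : Real.exp z * Real.exp (-z) = 1 := by rw [← Real.exp_add]; simp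
    have h4 := Real.exp_pos z
    have h5 : Real.exp z - 1 ≤ Real.exp z * z := by nlinarith
    nlinarith [sq_nonneg z, mul_nonneg (neg_nonneg.2 h) (sub_nonneg.2 h5)]

/-- If the logits at `s` move by `k` times `π(a | s) c(a)`, where `c` has mean zero under `π`,
then the mean of `c` increases. -/
lemma sum_softmaxPolicy_add_mul_ge (θ z : EuclideanSpace ℝ (S × A)) {η : ℝ}
    (hz : ∀ s a, |z (s, a)| ≤ η) (s : S) (c : A → ℝ) {k : ℝ} (hk : 0 ≤ k)
    (hzc : ∀ a, z (s, a) = k * ((softmaxPolicy θ s).1 a * c a))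
    (hc : ∑ a, (softmaxPolicy θ s).1 a * c a = 0) :
    Real.exp (-(2 * η)) * (k * ∑ a, ((softmaxPolicy θ s).1 a * c a) ^ 2)
      ≤ ∑ a, (softmaxPolicy (θ + z) s).1 a * c a := by
  have hZ := sum_softmaxPolicy_mul_exp_pos θ z s
  -- After multiplication by `k` this is `mul_exp_sub_one_ge`, because `z = k π c`. The zero mean of
  -- `c` allows `exp z` to be replaced by `exp z - 1` in `h2`.
  have h1 : ∀ a, Real.exp (-η) * (k * ((softmaxPolicy θ s).1 a * c a) ^ 2)
      ≤ (softmaxPolicy θ s).1 a * c a * (Real.exp (z (s, a)) - 1) := fun a => by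
    rcases hk.eq_or_lt with h | h
    · simp [hzc, ← h]
    · refine le_of_mul_le_mul_left ?_ h
      have := mul_exp_sub_one_ge (hz s a)
      rw [hzc] at this ⊢
      linarith
  have h2 : ∑ a, (softmaxPolicy (θ + z) s).1 a * c a
      = (∑ a, (softmaxPolicy θ s).1 a * c a * (Real.exp (z (s, a)) - 1))
        / ∑ b, (softmaxPolicy θ s).1 b * Real.exp (z (s, b)) := by
    simp only [mul_sub, mul_one, Finset.sum_sub_distrib, hc, sub_zero, softmaxPolicy_add,
      Finset.sum_div]
    exact Finset.sum_congr rfl fun a _ => by ring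
  rw [h2, le_div_iff₀ hZ]
  have h3 : 0 ≤ k * ∑ a, ((softmaxPolicy θ s).1 a * c a) ^ 2 := by positivity
  calc _ ≤ Real.exp (-(2 * η)) * (k * ∑ a, ((softmaxPolicy θ s).1 a * c a) ^ 2) * Real.exp η :=
        mul_le_mul_of_nonneg_left (sum_softmaxPolicy_mul_exp_le θ z hz s) (by positivity)
    _ = Real.exp (-η) * (k * ∑ a, ((softmaxPolicy θ s).1 a * c a) ^ 2) := by
        rw [mul_right_comm, ← Real.exp_add]
        ring_nf
    _ ≤ _ := by
        rw [Finset.mul_sum, Finset.mul_sum]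
        exact Finset.sum_le_sum fun a _ => h1 a

end SoftmaxUpdate

/-! ### Ascent of one normalized gradient step -/

section NormalizedStep

variable {S A : Type*} [Fintype S] [Fintype A] [DecidableEq S] [Nonempty A] (M : FiniteMDP S A)
  (μ : stdSimplex ℝ S) (θ : EuclideanSpace ℝ (S × A)) {η : ℝ}

lemma abs_normalized_step_le (hη : 0 ≤ η) (s : S) (a : A) :
    |((η / ‖M.policyGradient μ θ‖) • M.policyGradient μ θ) (s, a)| ≤ η := by
  refine (PiLp.norm_apply_le (p := 2) ((η / ‖M.policyGradient μ θ‖) • M.policyGradient μ θ)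
    (s, a)).trans ?_
  rw [norm_smul, Real.norm_of_nonneg (div_nonneg hη (norm_nonneg _))]
  -- At a vanishing gradient `η / 0 = 0`, so the step is zero.
  rcases eq_or_ne ‖M.policyGradient μ θ‖ 0 with h | h
  · rw [h, mul_zero]
    exact hη
  · rw [div_mul_cancel₀ _ h]

lemma normalized_step_apply (s : S) (a : A) :
    ((η / ‖M.policyGradient μ θ‖) • M.policyGradient μ θ) (s, a)
      = η / ‖M.policyGradient μ θ‖ * (1 / (1 - M.γ) * M.stateDist (softmaxPolicy θ) μ s)
        * ((softmaxPolicy θ s).1 a * M.advantage (softmaxPolicy θ) s a) := by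
  rw [PiLp.smul_apply, policyGradient_apply, smul_eq_mul, mul_assoc (η / _)]

lemma normalized_step_coeff_nonneg (hη : 0 ≤ η) (s : S) :
    0 ≤ η / ‖M.policyGradient μ θ‖ * (1 / (1 - M.γ) * M.stateDist (softmaxPolicy θ) μ s) :=
  mul_nonneg (div_nonneg hη (norm_nonneg _))
    (mul_nonneg (one_div_pos.2 M.one_sub_γ_pos).le (M.stateDist_nonneg _ μ s))

lemma sum_mul_advantage_normalized_step_ge (hη : 0 ≤ η) (s : S) :
    Real.exp (-(2 * η)) * (η / ‖M.policyGradient μ θ‖ *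
        (1 / (1 - M.γ) * M.stateDist (softmaxPolicy θ) μ s) *
        ∑ a, ((softmaxPolicy θ s).1 a * M.advantage (softmaxPolicy θ) s a) ^ 2)
      ≤ ∑ a, (softmaxPolicy (θ + (η / ‖M.policyGradient μ θ‖) • M.policyGradient μ θ) s).1 a
          * M.advantage (softmaxPolicy θ) s a :=
  sum_softmaxPolicy_add_mul_ge θ _ (M.abs_normalized_step_le μ θ hη) s _
    (M.normalized_step_coeff_nonneg μ θ hη s) (M.normalized_step_apply μ θ s)
    (M.sum_mul_advantage_self _ s)

/-- A normalized policy gradient step does not decrease the value of any state. -/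
lemma value_le_value_normalized_step (hη : 0 ≤ η) (s : S) :
    M.value (softmaxPolicy θ) s ≤ M.value
      (softmaxPolicy (θ + (η / ‖M.policyGradient μ θ‖) • M.policyGradient μ θ)) s :=
  M.value_le_value _ _ (fun x => (mul_nonneg (Real.exp_pos _).le
    (mul_nonneg (M.normalized_step_coeff_nonneg μ θ hη x)
      (Finset.sum_nonneg fun _ _ => sq_nonneg _))).trans
    (M.sum_mul_advantage_normalized_step_ge μ θ hη x)) s

variable {μ}

lemma valueAt_normalized_step_ge (hμ : ∀ s, 0 < μ.1 s) (hη : 0 ≤ η)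
    (hη' : 4 * η * (1 + (M.maxMismatch μ μ - (1 - M.γ)) / (1 - M.γ)) ≤ 1) :
    M.valueAt (softmaxPolicy θ) μ + η / 2 * ‖M.policyGradient μ θ‖ ≤ M.valueAt
      (softmaxPolicy (θ + (η / ‖M.policyGradient μ θ‖) • M.policyGradient μ θ)) μ := by
  set g := M.policyGradient μ θ with hg
  set π := softmaxPolicy θ with hπ
  set π' := softmaxPolicy (θ + (η / ‖g‖) • g) with hπ'
  set D := (M.maxMismatch μ μ - (1 - M.γ)) / (1 - M.γ) with hD
  have hγ := one_div_pos.2 M.one_sub_γ_pos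
  have hD0 : 0 ≤ D := div_nonneg (sub_nonneg.2 (M.one_sub_γ_le_maxMismatch hμ π))
    M.one_sub_γ_pos.le
  have hE := Real.add_one_le_exp (-(2 * η))
  have hEE : Real.exp (-(2 * η)) * Real.exp (2 * η) = 1 := by rw [← Real.exp_add]; simp
  have hE0 := Real.exp_pos (-(2 * η))
  -- The factor equals `exp (-(2 * η)) * (1 + D) - D`, which is at least `1 - 2 * η * (1 + D)`; the
  -- step size condition makes this at least `1 / 2`.
  have hfac : 1 / 2 ≤ Real.exp (-(2 * η)) * (1 - (Real.exp (2 * η) - 1) * D) := by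
    have : Real.exp (-(2 * η)) * (1 - (Real.exp (2 * η) - 1) * D)
        = Real.exp (-(2 * η)) * (1 + D) - D := by linear_combination -D * hEE
    rw [this]
    nlinarith
  have hfac0 : 0 ≤ 1 - (Real.exp (2 * η) - 1) * D :=
    (pos_of_mul_pos_right (lt_of_lt_of_le (by norm_num) hfac) hE0.le).le
  have hd := M.le_stateDist_of_le_mul hμ π π' (E := Real.exp (2 * η))
    (Real.one_le_exp (by linarith))
    (softmaxPolicy_le_exp_mul θ _ (M.abs_normalized_step_le μ θ hη))
  have hnorm : ‖g‖ ^ 2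
      = ∑ x, (1 / (1 - M.γ) * M.stateDist π μ x) ^ 2 *
        ∑ a, ((π x).1 a * M.advantage π x a) ^ 2 := by
    rw [EuclideanSpace.real_norm_sq_eq, Fintype.sum_prod_type]
    refine Finset.sum_congr rfl fun x _ => ?_
    rw [Finset.mul_sum]
    exact Finset.sum_congr rfl fun a _ => by rw [hg, policyGradient_apply, mul_pow]
  have hmain : Real.exp (-(2 * η)) * (1 - (Real.exp (2 * η) - 1) * D) * (η / ‖g‖ * ‖g‖ ^ 2)
      ≤ M.valueAt π' μ - M.valueAt π μ := by
    rw [valueAt_sub_valueAt, hnorm, Finset.mul_sum, Finset.mul_sum, Finset.mul_sum]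
    refine Finset.sum_le_sum fun x _ => ?_
    have hx := M.sum_mul_advantage_normalized_step_ge μ θ hη x
    have hnn : 0 ≤ Real.exp (-(2 * η)) * (η / ‖g‖ * (1 / (1 - M.γ) * M.stateDist π μ x) *
        ∑ a, ((π x).1 a * M.advantage π x a) ^ 2) :=
      mul_nonneg hE0.le (mul_nonneg (M.normalized_step_coeff_nonneg μ θ hη x)
        (Finset.sum_nonneg fun _ _ => sq_nonneg _))
    have h := mul_le_mul_of_nonneg_left
      (mul_le_mul (hd x) hx hnn (M.stateDist_nonneg π' μ x)) hγ.le
    refine le_trans (le_of_eq ?_) h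
    ring
  have hgg : η / ‖g‖ * ‖g‖ ^ 2 = η * ‖g‖ := by
    rcases eq_or_ne ‖g‖ 0 with h | h
    · simp [h]
    · field_simp
  rw [hgg] at hmain
  have := mul_le_mul_of_nonneg_right hfac (mul_nonneg hη (norm_nonneg g))
  linarith

lemma stepSize_pos [Nonempty S] (hμ : ∀ s, 0 < μ.1 s) : 0 < M.stepSize μ := by
  have hγ := M.one_sub_γ_pos
  have hC := M.one_sub_γ_le_maxMismatch hμ (softmaxPolicy (0 : EuclideanSpace ℝ (S × A)))
  have hS : (0 : ℝ) < Fintype.card S := Nat.cast_pos.2 Fintype.card_pos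
  exact mul_pos (div_pos hγ (by linarith)) (one_div_pos.2 (Real.sqrt_pos.2 hS))

lemma four_mul_stepSize_mul_le [Nonempty S] (hμ : ∀ s, 0 < μ.1 s) :
    4 * M.stepSize μ * (1 + (M.maxMismatch μ μ - (1 - M.γ)) / (1 - M.γ)) ≤ 1 := by
  have hγ := M.one_sub_γ_pos
  have hC := M.one_sub_γ_le_maxMismatch hμ (softmaxPolicy (0 : EuclideanSpace ℝ (S × A)))
  have hS : 1 ≤ √(Fintype.card S : ℝ) :=
    Real.one_le_sqrt.2 (Nat.one_le_cast.2 Fintype.card_pos)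
  have hden : 0 < 6 * (1 - M.γ) + 8 * (M.maxMismatch μ μ - (1 - M.γ)) := by linarith
  have h1 : M.stepSize μ
      ≤ (1 - M.γ) / (6 * (1 - M.γ) + 8 * (M.maxMismatch μ μ - (1 - M.γ))) :=
    mul_le_of_le_one_right (div_pos hγ hden).le ((div_le_one (by linarith)).2 hS)
  have h2 : 1 + (M.maxMismatch μ μ - (1 - M.γ)) / (1 - M.γ) = M.maxMismatch μ μ / (1 - M.γ) := by
    field_simp
    ring
  rw [h2]
  calc _ ≤ 4 * ((1 - M.γ) / (6 * (1 - M.γ) + 8 * (M.maxMismatch μ μ - (1 - M.γ))))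
        * (M.maxMismatch μ μ / (1 - M.γ)) := by
        gcongr
        exact div_nonneg (hγ.le.trans hC) hγ.le
    _ = 4 * M.maxMismatch μ μ / (6 * (1 - M.γ) + 8 * (M.maxMismatch μ μ - (1 - M.γ))) := by
        field_simp
    _ ≤ 1 := by
        rw [div_le_one hden]
        linarith

end NormalizedStep

section Auxiliary

variable {S A : Type*} [Fintype A]

lemma sum_detPolicy_mul [DecidableEq A] (b : S → A) (s : S) (f : A → ℝ) :
    ∑ a, (detPolicy b s).1 a * f a = f (b s) := by
  simp [detPolicy, Pi.single_apply]

lemma sum_abs_apply_le_sqrt_card_mul_norm [Fintype S] (g : EuclideanSpace ℝ (S × A))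
    (b : S → A) : ∑ s, |g (s, b s)| ≤ √(Fintype.card S) * ‖g‖ := by
  refine abs_le_of_sq_le_sq' ?_ (by positivity) |>.2
  rw [mul_pow, Real.sq_sqrt (Nat.cast_nonneg _), EuclideanSpace.real_norm_sq_eq,
    Fintype.sum_prod_type]
  refine sq_sum_le_card_mul_sum_sq.trans (mul_le_mul_of_nonneg_left
    (Finset.sum_le_sum fun s _ => ?_) (Nat.cast_nonneg _))
  rw [sq_abs]
  exact Finset.single_le_sum (f := fun a => g (s, a) ^ 2) (fun a _ => sq_nonneg _)
    (Finset.mem_univ (b s))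

end Auxiliary

/-! ### Optimality gap and the Łojasiewicz inequality -/

section OptimalPolicy

variable {S A : Type*} [Fintype S] [Fintype A] [DecidableEq S] (M : FiniteMDP S A)

lemma one_le_occupancy_self (π : Policy S A) (s : S) : 1 ≤ M.occupancy π s s := by
  rw [M.occupancy_eq π, Matrix.add_apply, Matrix.one_apply_eq, le_add_iff_nonneg_right,
    Matrix.mul_apply]
  exact Finset.sum_nonneg fun x _ => mul_nonneg (M.occupancy_nonneg π s x)
    (mul_nonneg M.γ_nonneg (M.transMatrix_nonneg π x s))

variable {M}

/-- Switching to `a` in the single state `s` would gain the advantage times the occupancy of `s`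
from `s`, which is at least one. -/
lemma IsOptimal.advantage_nonpos {π : Policy S A} (h : M.IsOptimal π) (s : S) (a : A) :
    M.advantage π s a ≤ 0 := by
  classical
  by_contra! ha
  set π' : Policy S A := Function.update π s ⟨Pi.single a 1, single_mem_stdSimplex ℝ a⟩ with hπ'
  have h1 : ∀ x, x ≠ s → ∑ b, (π' x).1 b * M.advantage π x b = 0 := fun x hx => by
    rw [hπ', Function.update_of_ne hx, sum_mul_advantage_self]
  have h2 : ∑ b, (π' s).1 b * M.advantage π s b = M.advantage π s a := by
    simp [hπ', Pi.single_apply]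
  have h3 := M.value_sub_value π π' s
  rw [Finset.sum_eq_single s (fun x _ hx => by rw [h1 x hx, mul_zero]) (by simp), h2] at h3
  have h4 := mul_pos (zero_lt_one.trans_le (M.one_le_occupancy_self π' s)) ha
  linarith [h π' s]

lemma maxMismatch_nonneg (ρ μ : stdSimplex ℝ S) : 0 ≤ M.maxMismatch ρ μ :=
  Real.iSup_nonneg fun _ => norm_nonneg _

/-- Changing the initial distribution costs at most `C'_∞ / (1 - γ)` in the optimality gap. -/
lemma IsOptimal.valueAt_gap_le {πs : Policy S A} (h : M.IsOptimal πs) {μ : stdSimplex ℝ S}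
    (hμ : ∀ s, 0 < μ.1 s) (ρ : stdSimplex ℝ S) (π : Policy S A) :
    M.valueAt πs ρ - M.valueAt π ρ
      ≤ (M.valueAt πs μ - M.valueAt π μ) * M.maxMismatch ρ μ / (1 - M.γ) := by
  have hγ := M.one_sub_γ_pos
  -- Performance difference with the optimal policy as base: the distributions are those of `π`, and
  -- every summand is nonnegative, so they can be compared state by state through `μ`.
  have e : ∀ ν : stdSimplex ℝ S, M.valueAt πs ν - M.valueAt π ν
      = 1 / (1 - M.γ) * ∑ x, M.stateDist π ν x * -∑ a, (π x).1 a * M.advantage πs x a := fun ν => by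
    rw [← neg_sub (M.valueAt π ν), valueAt_sub_valueAt]
    simp only [mul_neg, Finset.sum_neg_distrib]
  rw [e, e, mul_assoc, mul_div_assoc, mul_div_assoc]
  refine mul_le_mul_of_nonneg_left ?_ (one_div_pos.2 hγ).le
  rw [Finset.sum_mul]
  refine Finset.sum_le_sum fun x _ => ?_
  rw [mul_right_comm]
  have hA : ∑ a, (π x).1 a * M.advantage πs x a ≤ 0 := Finset.sum_nonpos fun a _ =>
    mul_nonpos_of_nonneg_of_nonpos ((π x).2.1 a) (h.advantage_nonpos x a)
  refine mul_le_mul_of_nonneg_right ?_ (neg_nonneg.2 hA)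
  refine (M.stateDist_le_maxMismatch hμ π ρ x).trans ?_
  rw [← mul_div_assoc, le_div_iff₀ hγ, mul_comm (M.stateDist π μ x), mul_assoc]
  refine mul_le_mul_of_nonneg_left ?_ (maxMismatch_nonneg ρ μ)
  rw [mul_comm]
  exact M.le_stateDist π μ x

lemma IsOptimal.valueAt_le {πs : Policy S A} (h : M.IsOptimal πs) (π : Policy S A)
    (ρ : stdSimplex ℝ S) : M.valueAt π ρ ≤ M.valueAt πs ρ :=
  Finset.sum_le_sum fun s _ => mul_le_mul_of_nonneg_left (h π s) (ρ.2.1 s)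

/-- A function that dominates its one-step lookahead under a policy dominates its value. -/
lemma value_le_of_lookahead_le (π : Policy S A) (f : S → ℝ)
    (h : ∀ s, ∑ a, (π s).1 a * (M.r s a + M.γ * ∑ s', (M.P s a).1 s' * f s') ≤ f s) (s : S) :
    M.value π s ≤ f s := by
  rw [value_eq, M.eq_occupancy_mulVec π f s]
  refine Finset.sum_le_sum fun x _ => mul_le_mul_of_nonneg_left ?_ (M.occupancy_nonneg π s x)
  have := h x
  simp only [mul_add, mul_left_comm _ M.γ, Finset.sum_add_distrib, ← Finset.mul_sum] at this
  rw [sum_transMatrix_mul]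
  linarith

variable [DecidableEq A] [Nonempty A]

/-- The non-uniform Łojasiewicz inequality. -/
lemma lojasiewicz {μ : stdSimplex ℝ S} (hμ : ∀ s, 0 < μ.1 s) (b : S → A)
    (θ : EuclideanSpace ℝ (S × A)) {c : ℝ} (hc : ∀ s, c ≤ (softmaxPolicy θ s).1 (b s))
    (hc0 : 0 ≤ c) :
    c * (1 - M.γ) * (M.valueAt (detPolicy b) μ - M.valueAt (softmaxPolicy θ) μ)
      ≤ M.mismatch (detPolicy b) μ μ * (√(Fintype.card S) * ‖M.policyGradient μ θ‖) := by
  have hγ := M.one_sub_γ_pos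
  set g := M.policyGradient μ θ with hg
  set π := softmaxPolicy θ with hπ
  set m := M.mismatch (detPolicy b) μ μ with hm
  have hm0 : 0 ≤ m := norm_nonneg _
  have hg' : ∀ x, |g (x, b x)| = 1 / (1 - M.γ) *
      (M.stateDist π μ x * ((π x).1 (b x) * |M.advantage π x (b x)|)) := fun x => by
    rw [hg, policyGradient_apply, abs_mul, abs_mul, abs_mul, ← hπ,
      abs_of_nonneg (one_div_pos.2 hγ).le, abs_of_nonneg (M.stateDist_nonneg π μ x),
      abs_of_nonneg ((π x).2.1 _), mul_assoc]
  have h1 : c * (1 - M.γ) * (M.valueAt (detPolicy b) μ - M.valueAt π μ)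
      ≤ m * ∑ x, |g (x, b x)| := by
    rw [valueAt_sub_valueAt, Finset.mul_sum, Finset.mul_sum, Finset.mul_sum]
    refine Finset.sum_le_sum fun x _ => ?_
    rw [sum_detPolicy_mul, hg']
    have hA := abs_nonneg (M.advantage π x (b x))
    -- Both sides are compared with `m * (1 - γ) * μ`.
    have hd : (1 - M.γ) * M.stateDist (detPolicy b) μ x ≤ m * M.stateDist π μ x := by
      have h1 := mul_le_mul_of_nonneg_left (M.stateDist_le_mismatch hμ (detPolicy b) μ x) hγ.le
      have h2 := mul_le_mul_of_nonneg_left (M.le_stateDist π μ x) hm0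
      linarith
    calc _ ≤ c * (1 - M.γ) * (1 / (1 - M.γ) *
          (M.stateDist (detPolicy b) μ x * |M.advantage π x (b x)|)) := by
          gcongr
          · exact M.stateDist_nonneg _ μ x
          · exact le_abs_self _
      _ = 1 / (1 - M.γ) * (c * ((1 - M.γ) * M.stateDist (detPolicy b) μ x) *
          |M.advantage π x (b x)|) := by ring
      _ ≤ 1 / (1 - M.γ) * ((π x).1 (b x) * (m * M.stateDist π μ x) *
          |M.advantage π x (b x)|) := by
          gcongr
          · exact mul_nonneg hγ.le (M.stateDist_nonneg _ μ x)
          · exact (π x).2.1 _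
          · exact hc x
      _ = _ := by ring
  refine h1.trans (mul_le_mul_of_nonneg_left ?_ hm0)
  exact sum_abs_apply_le_sqrt_card_mul_norm g b

end OptimalPolicy

end FiniteMDP

/-! ### No positive limiting advantage -/

open Filter Topology in
/-- Softmax logits `x t` with probabilities `p t` that move along `p · adv`, where `adv` has mean
zero and converges: if the steps' directions tend to `0`, no limiting advantage is positive. -/
lemma limit_advantage_nonpos {A : Type*} [Fintype A] {x p adv : ℕ → A → ℝ} {k : ℕ → ℝ}
    {L : A → ℝ} (hk : ∀ t, 0 ≤ k t) (hp0 : ∀ t a, 0 < p t a)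
    (hp : ∀ t a b, p t a = Real.exp (x t a - x t b) * p t b) (hp1 : ∀ t, ∑ a, p t a = 1)
    (hsum : ∀ t, ∑ a, p t a * adv t a = 0)
    (hstep : ∀ t a, x (t + 1) a = x t a + k t * (p t a * adv t a))
    (hL : ∀ a, Tendsto (fun t => adv t a) atTop (𝓝 (L a)))
    (h0 : ∀ a, Tendsto (fun t => p t a * adv t a) atTop (𝓝 0)) (b : A) : L b ≤ 0 := by
  classical
  by_contra! hb
  -- The contradiction will be that all probabilities tend to zero while summing to one. Nonzero
  -- limits are immediate; actions with limit zero take the rest of the proof.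
  have hpz : ∀ a, L a ≠ 0 → Tendsto (fun t => p t a) atTop (𝓝 0) := fun a ha => by
    have h := (h0 a).div (hL a) ha
    rw [zero_div] at h
    refine h.congr' ?_
    filter_upwards [(hL a).eventually_ne ha] with t ht
    exact mul_div_cancel_right₀ _ ht
  obtain ⟨δ, hδ, hδL⟩ : ∃ δ, 0 < δ ∧ δ < L b := exists_between hb
  have hn : (0 : ℝ) < Fintype.card A := Nat.cast_pos.2 (Fintype.card_pos_iff.2 ⟨b⟩)
  have hn1 : (1 : ℝ) ≤ Fintype.card A := Nat.one_le_cast.2 (Fintype.card_pos_iff.2 ⟨b⟩)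
  -- Chosen so that `(ε + ε) / δ` is one over the number of actions.
  set ε : ℝ := δ / (2 * Fintype.card A) with hε
  have hε0 : 0 < ε := div_pos hδ (by positivity)
  have hεδ : ε ≤ δ := div_le_self hδ.le (by linarith)
  set K : ℝ := ∑ a, |L a| + 1 with hK
  have hK0 : 0 < K := by positivity
  have hev : ∀ᶠ t in atTop, δ ≤ adv t b ∧ ∀ a, -K ≤ adv t a ∧ (L a < 0 → adv t a ≤ 0) ∧
      (0 < L a → 0 ≤ adv t a) ∧ (L a = 0 → -ε ≤ adv t a ∧ adv t a ≤ ε) := by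
    refine ((hL b).eventually_const_le hδL).and (eventually_all.2 fun a => ?_)
    have hKa : -K < L a := by
      have := Finset.single_le_sum (f := fun a => |L a|) (fun a _ => abs_nonneg _)
        (Finset.mem_univ a)
      linarith [neg_abs_le (L a)]
    refine ((hL a).eventually_const_le hKa).and ?_
    rcases lt_trichotomy (L a) 0 with h | h | h
    · filter_upwards [(hL a).eventually_le_const h] with t ht
      exact ⟨fun _ => ht, fun h' => absurd h' h.not_gt, fun h' => absurd h' h.ne⟩
    · filter_upwards [(hL a).eventually_le_const (h.trans_lt hε0),
        (hL a).eventually_const_le (by rw [h]; linarith : -ε < L a)] with t ht ht'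
      exact ⟨fun h' => absurd h h'.ne, fun h' => absurd h h'.ne', fun _ => ⟨ht', ht⟩⟩
    · filter_upwards [(hL a).eventually_const_le h] with t ht
      exact ⟨fun h' => absurd h' h.not_gt, fun _ => ht, fun h' => absurd h' h.ne'⟩
  obtain ⟨T, hT⟩ := eventually_atTop.1 hev
  set D : ℕ → ℝ := fun t => k t * (p t b * adv t b) with hD
  have hDge : ∀ t, T ≤ t → k t * p t b * δ ≤ D t := fun t ht => by
    rw [hD]
    simp only [← mul_assoc]
    exact mul_le_mul_of_nonneg_left (hT t ht).1 (mul_nonneg (hk t) (hp0 t b).le)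
  have hD0 : ∀ t, T ≤ t → 0 ≤ D t := fun t ht =>
    (mul_nonneg (mul_nonneg (hk t) (hp0 t b).le) hδ.le).trans (hDge t ht)
  have hxb : ∀ s t, T ≤ s → s ≤ t → x s b ≤ x t b := fun s t hs hst => by
    induction t, hst using Nat.le_induction with
    | base => exact le_rfl
    | succ t hst ih =>
      rw [hstep]
      linarith [hD0 t (hs.trans hst)]
  have hneg : ∀ a, L a < 0 → ∀ t, T ≤ t → x t a ≤ x T a := fun a ha t ht => by
    induction t, ht using Nat.le_induction with
    | base => exact le_rfl
    | succ t ht ih =>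
      rw [hstep]
      have := mul_nonneg (hk t) (mul_nonneg (hp0 t a).le
        (neg_nonneg.2 (((hT t ht).2 a).2.1 ha)))
      linarith
  have hple : ∀ t a, x t a ≤ x t b → p t a ≤ p t b := fun t a h => by
    rw [hp t a b]
    exact mul_le_of_le_one_left (hp0 t b).le (Real.exp_le_one_iff.2 (by linarith))
  -- the actions of limiting advantage zero whose logit always dominates that of `b`
  set B : Finset A := {a | L a = 0 ∧ ∀ t, T ≤ t → x t b < x t a} with hB
  -- Once the logit of such an action is below that of `b`, it stays below: both its probability and
  -- its advantage are then at most those of `b`, so it grows no faster.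
  have hBc : ∀ᶠ t in atTop, ∀ a, L a = 0 → a ∉ B → x t a ≤ x t b := by
    refine eventually_all.2 fun a => ?_
    by_cases ha : L a = 0 ∧ a ∉ B
    · obtain ⟨ha0, haB⟩ := ha
      have : ∃ s, T ≤ s ∧ x s a ≤ x s b := by
        by_contra! h
        exact haB (by simpa [hB] using ⟨ha0, h⟩)
      obtain ⟨s, hs, hsx⟩ := this
      filter_upwards [eventually_ge_atTop s] with t hst _ _
      induction t, hst using Nat.le_induction with
      | base => exact hsx
      | succ t hst ih =>
        rw [hstep, hstep]
        have hTt := hT t (hs.trans hst)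
        have h1 : p t a * adv t a ≤ p t b * adv t b := by
          rcases le_total (adv t a) 0 with h | h
          · exact (mul_nonpos_of_nonneg_of_nonpos (hp0 t a).le h).trans
              (mul_nonneg (hp0 t b).le (hδ.le.trans hTt.1))
          · exact mul_le_mul (hple t a ih)
              ((((hTt.2 a).2.2.2 ha0).2.trans hεδ).trans hTt.1) h (hp0 t b).le
        linarith [mul_le_mul_of_nonneg_left h1 (hk t)]
    · exact Eventually.of_forall fun t h h' => absurd ⟨h, h'⟩ ha
  have hbB : b ∉ B := by simp [hB, hb.ne']
  -- Logit increments over all actions sum to zero, so the growth on `B` is paid for by the other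
  -- actions.
  have hsumB : ∀ t, ∑ a ∈ B, (x (t + 1) a - x t a)
      = ∑ a ∈ Bᶜ, -(k t * (p t a * adv t a)) := fun t => by
    have h := hsum t
    rw [← Finset.sum_add_sum_compl B] at h
    rw [Finset.sum_neg_distrib, ← Finset.mul_sum, eq_neg_of_add_eq_zero_right h, mul_neg, neg_neg,
      Finset.mul_sum]
    exact Finset.sum_congr rfl fun a _ => by rw [hstep]; ring
  have hcompl : ∀ᶠ t in atTop, ∀ a ∈ Bᶜ, -(k t * (p t a * adv t a)) ≤
      (ε + if L a < 0 then K * Real.exp (x T a - x t b) else 0) / δ * D t := by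
    filter_upwards [hBc, eventually_ge_atTop T] with t hBt ht a ha
    have hkp := mul_nonneg (hk t) (hp0 t b).le
    have hTa := (hT t ht).2 a
    have aux : ∀ c, 0 ≤ c → k t * p t b * c ≤ c / δ * D t := fun c hc => by
      rw [div_mul_eq_mul_div, le_div_iff₀ hδ]
      nlinarith [mul_le_mul_of_nonneg_left (hDge t ht) hc]
    rcases lt_trichotomy (L a) 0 with h | h | h
    · rw [if_pos h]
      refine le_trans ?_ (aux _ (by positivity))
      have h1 : p t a ≤ Real.exp (x T a - x t b) * p t b := by
        rw [hp t a b]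
        exact mul_le_mul_of_nonneg_right (Real.exp_le_exp.2 (by linarith [hneg a h t ht]))
          (hp0 t b).le
      calc -(k t * (p t a * adv t a)) = k t * p t a * -adv t a := by ring
        _ ≤ k t * p t a * K := mul_le_mul_of_nonneg_left (by linarith [hTa.1])
            (mul_nonneg (hk t) (hp0 t a).le)
        _ ≤ k t * (Real.exp (x T a - x t b) * p t b) * K := by gcongr; exact hk t
        _ ≤ _ := by nlinarith
    · rw [if_neg h.not_lt, add_zero]
      refine le_trans ?_ (aux _ hε0.le)
      calc -(k t * (p t a * adv t a)) = k t * p t a * -adv t a := by ring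
        _ ≤ k t * p t a * ε := mul_le_mul_of_nonneg_left (by linarith [(hTa.2.2.2 h).1])
            (mul_nonneg (hk t) (hp0 t a).le)
        _ ≤ k t * p t b * ε := by
            gcongr
            · exact hk t
            · exact hple t a (hBt a h (Finset.mem_compl.1 ha))
    · rw [if_neg h.not_gt, add_zero]
      refine le_trans ?_ (aux _ hε0.le)
      have := mul_nonneg (hk t) (mul_nonneg (hp0 t a).le (hTa.2.2.1 h))
      nlinarith [mul_nonneg hkp hε0.le]
  -- If the logit of `b` is bounded, `C` is the sum of the ratios from `hcompl`, frozen at time `T`.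
  -- Otherwise it tends to infinity, the exponential terms fall below `ε`, and the other actions
  -- together contribute at most `D t`, cancelled by the term `-D t` of `b`; then `C = 0` works.
  obtain ⟨C, U, hC, hU⟩ : ∃ C U : ℝ, (∀ᶠ t in atTop, ∑ a ∈ B, (x (t + 1) a - x t a) ≤ C * D t) ∧
      ∀ t, T ≤ t → C * x t b ≤ U := by
    by_cases hbd : ∃ U, ∀ t, T ≤ t → x t b ≤ U
    · obtain ⟨U, hU⟩ := hbd
      set R : A → ℝ := fun a => (ε + if L a < 0 then K * Real.exp (x T a - x T b) else 0) / δ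
        with hR
      have hR0 : ∀ a, 0 ≤ R a := fun a => by rw [hR]; positivity
      refine ⟨∑ a ∈ Bᶜ, R a, (∑ a ∈ Bᶜ, R a) * U, ?_, fun t ht =>
        mul_le_mul_of_nonneg_left (hU t ht) (Finset.sum_nonneg fun a _ => hR0 a)⟩
      filter_upwards [hcompl, eventually_ge_atTop T] with t hc ht
      rw [hsumB, Finset.sum_mul]
      refine Finset.sum_le_sum fun a ha => (hc a ha).trans
        (mul_le_mul_of_nonneg_right ?_ (hD0 t ht))
      simp only [hR]
      gcongr
      split_ifs
      · have := hxb T t le_rfl ht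
        gcongr
      · exact le_rfl
    · push Not at hbd
      refine ⟨0, 0, ?_, fun t _ => by simp⟩
      have htop : Tendsto (fun t => x t b) atTop atTop := by
        refine tendsto_atTop.2 fun U => ?_
        obtain ⟨s, hs, hsU⟩ := hbd U
        filter_upwards [eventually_ge_atTop s] with t ht
        exact hsU.le.trans (hxb s t hs ht)
      have hexp : ∀ᶠ t in atTop, ∀ a, K * Real.exp (x T a - x t b) ≤ ε := by
        refine eventually_all.2 fun a => ?_
        have h : Tendsto (fun t => K * Real.exp (x T a - x t b)) atTop (𝓝 (K * 0)) :=
          (Real.tendsto_exp_atBot.comp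
            (tendsto_const_nhds.add_atBot (tendsto_neg_atTop_atBot.comp htop))).const_mul K
        rw [mul_zero] at h
        exact h.eventually_le_const hε0
      filter_upwards [hcompl, hexp, eventually_ge_atTop T] with t hc he ht
      have hDt := hD0 t ht
      have h1 : ∀ a ∈ Bᶜ.erase b, -(k t * (p t a * adv t a)) ≤ D t / Fintype.card A :=
        fun a ha => by
        refine (hc a (Finset.mem_of_mem_erase ha)).trans ?_
        rw [div_eq_inv_mul (D t)]
        refine mul_le_mul_of_nonneg_right ?_ hDt
        have h2 : (if L a < 0 then K * Real.exp (x T a - x t b) else 0) ≤ ε := by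
          split_ifs
          · exact he a
          · exact hε0.le
        calc _ ≤ (ε + ε) / δ := by gcongr
          _ = _ := by rw [hε]; field_simp; norm_num
      have h3 : ∑ a ∈ Bᶜ.erase b, -(k t * (p t a * adv t a)) ≤ D t := by
        refine (Finset.sum_le_card_nsmul _ _ _ h1).trans ?_
        rw [nsmul_eq_mul, mul_div_left_comm]
        refine mul_le_of_le_one_right hDt (div_le_one_of_le₀ ?_ hn.le)
        exact_mod_cast Finset.card_le_univ _
      rw [hsumB, ← Finset.add_sum_erase _ _ (Finset.mem_compl.2 hbB), zero_mul]
      linarith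
  obtain ⟨T₁, hT₁⟩ := eventually_atTop.1 (hC.and (eventually_ge_atTop T))
  have hpb := hpz b hb.ne'
  have hpB : ∀ a ∈ B, Tendsto (fun t => p t a) atTop (𝓝 0) := fun a ha => by
    -- A nonincreasing potential from time `T₁` on, which bounds the sum of the logits on `B` above.
    -- Each of them stays above `x T b`, so each is bounded above too, and its probability is at
    -- most a constant times that of `b`.
    set Y : ℕ → ℝ := fun t => ∑ a ∈ B, x t a - C * x t b with hY
    have hYle : ∀ t, T₁ ≤ t → Y t ≤ Y T₁ := fun t ht => by
      induction t, ht using Nat.le_induction with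
      | base => exact le_rfl
      | succ t ht ih =>
        have h := (hT₁ t ht).1
        rw [Finset.sum_sub_distrib] at h
        refine le_trans ?_ ih
        simp only [hY]
        rw [hstep t b, mul_add]
        linarith
    set W : ℝ := Y T₁ + U - ∑ _a ∈ B, x T b with hW
    have hxW : ∀ t, T₁ ≤ t → x t a - x t b ≤ W := fun t ht => by
      have htT := (hT₁ t ht).2
      have hTb := hxb T t le_rfl htT
      have hpos : ∀ a ∈ B, 0 ≤ x t a - x T b := fun a ha => by
        have := (Finset.mem_filter.1 ha).2.2 t htT
        linarith
      have h1 := Finset.single_le_sum hpos ha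
      rw [Finset.sum_sub_distrib] at h1
      have h2 := hYle t ht
      have h3 := hU t htT
      simp only [hY] at h2 hW
      linarith
    refine squeeze_zero' (Eventually.of_forall fun t => (hp0 t a).le) ?_
      (by simpa using hpb.const_mul (Real.exp W))
    filter_upwards [eventually_ge_atTop T₁] with t ht
    rw [hp t a b]
    exact mul_le_mul_of_nonneg_right (Real.exp_le_exp.2 (hxW t ht)) (hp0 t b).le
  have hpall : ∀ a, Tendsto (fun t => p t a) atTop (𝓝 0) := fun a => by
    by_cases ha : L a = 0
    · by_cases haB : a ∈ B
      · exact hpB a haB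
      · refine squeeze_zero' (Eventually.of_forall fun t => (hp0 t a).le) ?_ hpb
        filter_upwards [hBc] with t ht
        exact hple t a (ht a ha haB)
    · exact hpz a ha
  have h := tendsto_finsetSum Finset.univ fun a _ => hpall a
  simp only [hp1, Finset.sum_const_zero] at h
  exact one_ne_zero (tendsto_nhds_unique tendsto_const_nhds h)

namespace FiniteMDP

/-! ### Convergence to the optimal value and positivity of `c` -/

section Convergence

open Filter Topology

variable {S A : Type*} [Fintype S] [Fintype A] [DecidableEq S] [Nonempty A] {M : FiniteMDP S A}
  {μ : stdSimplex ℝ S} {η : ℝ} {θ : ℕ → EuclideanSpace ℝ (S × A)}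

lemma IsGNPG.value_mono (hθ : M.IsGNPG μ η θ) (hη : 0 ≤ η) (s : S) :
    Monotone fun t => M.value (softmaxPolicy (θ (t + 1))) s :=
  monotone_nat_of_le_succ fun t => by
    rw [hθ (t + 1) t.succ_pos]
    exact M.value_le_value_normalized_step μ _ hη s

lemma IsGNPG.tendsto_norm_policyGradient (hθ : M.IsGNPG μ η θ) (hμ : ∀ s, 0 < μ.1 s) (hη : 0 < η)
    (hη' : 4 * η * (1 + (M.maxMismatch μ μ - (1 - M.γ)) / (1 - M.γ)) ≤ 1)
    {πs : Policy S A} (hopt : M.IsOptimal πs) :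
    Tendsto (fun t => ‖M.policyGradient μ (θ (t + 1))‖) atTop (𝓝 0) := by
  set v : ℕ → ℝ := fun t => M.valueAt (softmaxPolicy (θ (t + 1))) μ with hv
  have hstep : ∀ t, v t + η / 2 * ‖M.policyGradient μ (θ (t + 1))‖ ≤ v (t + 1) := fun t => by
    simp only [hv]
    rw [hθ (t + 1) t.succ_pos]
    exact M.valueAt_normalized_step_ge _ hμ hη.le hη'
  have hmono : Monotone v := monotone_nat_of_le_succ fun t =>
    (le_add_of_nonneg_right (by positivity)).trans (hstep t)
  have hlim := tendsto_atTop_ciSup hmono ⟨M.valueAt πs μ, by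
    rintro _ ⟨t, rfl⟩
    exact hopt.valueAt_le _ μ⟩
  have hdiff : Tendsto (fun t => 2 / η * (v (t + 1) - v t)) atTop (𝓝 0) := by
    simpa using ((hlim.comp (tendsto_add_atTop_nat 1)).sub hlim).const_mul (2 / η)
  refine squeeze_zero (fun t => norm_nonneg _) (fun t => ?_) hdiff
  have := hstep t
  rw [div_mul_eq_mul_div, le_div_iff₀ hη]
  linarith

/-- Normalized policy gradient converges to the optimal value in every state. -/
lemma IsGNPG.tendsto_value (hθ : M.IsGNPG μ η θ) (hμ : ∀ s, 0 < μ.1 s) (hη : 0 < η)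
    (hη' : 4 * η * (1 + (M.maxMismatch μ μ - (1 - M.γ)) / (1 - M.γ)) ≤ 1)
    {πs : Policy S A} (hopt : M.IsOptimal πs) :
    (∀ s, Tendsto (fun t => M.value (softmaxPolicy (θ (t + 1))) s) atTop (𝓝 (M.value πs s))) ∧
    ∀ s a, Tendsto (fun t => (softmaxPolicy (θ (t + 1)) s).1 a *
      M.advantage (softmaxPolicy (θ (t + 1))) s a) atTop (𝓝 0) := by
  have hγ := M.one_sub_γ_pos
  set f : S → ℝ := fun s => ⨆ t, M.value (softmaxPolicy (θ (t + 1))) s with hf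
  have hlim : ∀ s, Tendsto (fun t => M.value (softmaxPolicy (θ (t + 1))) s) atTop (𝓝 (f s)) :=
    fun s => tendsto_atTop_ciSup (hθ.value_mono hη.le s) ⟨M.value πs s, by
      rintro _ ⟨t, rfl⟩
      exact hopt _ s⟩
  have hadv : ∀ s a, Tendsto (fun t => M.advantage (softmaxPolicy (θ (t + 1))) s a) atTop
      (𝓝 (M.r s a + M.γ * ∑ s', (M.P s a).1 s' * f s' - f s)) := fun s a =>
    (((tendsto_finsetSum _ fun s' _ => (hlim s').const_mul _).const_mul _).const_add _).sub (hlim s)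
  -- A gradient entry is `π A` times a coefficient that is at least `μ s`, so a vanishing gradient
  -- forces `π A` to vanish.
  have hpa : ∀ s a, Tendsto (fun t => (softmaxPolicy (θ (t + 1)) s).1 a *
      M.advantage (softmaxPolicy (θ (t + 1))) s a) atTop (𝓝 0) := fun s a => by
    have h0 := (hθ.tendsto_norm_policyGradient hμ hη hη' hopt).const_mul (1 / μ.1 s)
    rw [mul_zero] at h0
    refine squeeze_zero_norm (fun t => ?_) h0
    have h1 := PiLp.norm_apply_le (p := 2) (M.policyGradient μ (θ (t + 1))) (s, a)
    rw [policyGradient_apply, norm_mul] at h1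
    have h2 : μ.1 s ≤ ‖1 / (1 - M.γ) * M.stateDist (softmaxPolicy (θ (t + 1))) μ s‖ := by
      refine le_trans ?_ (le_abs_self _)
      rw [one_div, inv_mul_eq_div, le_div_iff₀ hγ, mul_comm]
      exact M.le_stateDist _ μ s
    rw [one_div, inv_mul_eq_div, le_div_iff₀ (hμ s), mul_comm]
    exact (mul_le_mul_of_nonneg_right h2 (norm_nonneg _)).trans h1
  have hL : ∀ s a, M.r s a + M.γ * ∑ s', (M.P s a).1 s' * f s' - f s ≤ 0 := fun s a => by
    refine limit_advantage_nonpos (x := fun t a => θ (t + 1) (s, a))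
      (fun t => M.normalized_step_coeff_nonneg μ (θ (t + 1)) hη.le s)
      (fun t a => softmaxPolicy_pos (θ (t + 1)) s a) (fun t a b => ?_)
      (fun t => (softmaxPolicy (θ (t + 1)) s).2.2)
      (fun t => M.sum_mul_advantage_self (softmaxPolicy (θ (t + 1))) s) (fun t a => ?_)
      (hadv s) (hpa s) a
    · rw [softmaxPolicy_apply, softmaxPolicy_apply, ← mul_div_assoc, ← Real.exp_add,
        sub_add_cancel]
    · rw [hθ (t + 1) t.succ_pos, PiLp.add_apply, normalized_step_apply]
  -- By `hL` the limit `f` dominates its lookahead under every action, hence also the value of `πs`.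
  have hfeq : ∀ s, f s = M.value πs s := fun s => by
    refine le_antisymm (ciSup_le fun t => hopt _ s) (value_le_of_lookahead_le πs f (fun x => ?_) s)
    calc _ ≤ ∑ a, (πs x).1 a * f x := Finset.sum_le_sum fun a _ =>
          mul_le_mul_of_nonneg_left (sub_nonpos.1 (hL x a)) ((πs x).2.1 a)
      _ = f x := by rw [← Finset.sum_mul, (πs x).2.2, one_mul]
  exact ⟨fun s => hfeq s ▸ hlim s, hpa⟩

variable [DecidableEq A] {b : S → A}

lemma IsGNPG.tendsto_softmaxPolicy (hθ : M.IsGNPG μ η θ) (hμ : ∀ s, 0 < μ.1 s) (hη : 0 < η)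
    (hη' : 4 * η * (1 + (M.maxMismatch μ μ - (1 - M.γ)) / (1 - M.γ)) ≤ 1)
    (hopt : M.IsOptimal (detPolicy b))
    (huniq : ∀ s a, a ≠ b s → M.qValue (detPolicy b) s a < M.qValue (detPolicy b) s (b s))
    (s : S) : Tendsto (fun t => (softmaxPolicy (θ (t + 1)) s).1 (b s)) atTop (𝓝 1) := by
  obtain ⟨hV, hpa⟩ := hθ.tendsto_value hμ hη hη' hopt
  have hadv : ∀ a, Tendsto (fun t => M.advantage (softmaxPolicy (θ (t + 1))) s a) atTop
      (𝓝 (M.advantage (detPolicy b) s a)) := fun a =>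
    (((tendsto_finsetSum _ fun s' _ => (hV s').const_mul _).const_mul _).const_add _).sub (hV s)
  have hz : ∀ a ∈ Finset.univ.erase (b s),
      Tendsto (fun t => (softmaxPolicy (θ (t + 1)) s).1 a) atTop (𝓝 0) := fun a ha => by
    have hne : M.advantage (detPolicy b) s a ≠ 0 := by
      rw [advantage, M.value_bellman, sum_detPolicy_mul]
      exact (sub_neg.2 (huniq s a (Finset.ne_of_mem_erase ha))).ne
    have h := (hpa s a).div (hadv a) hne
    rw [zero_div] at h
    refine h.congr' ?_
    filter_upwards [(hadv a).eventually_ne hne] with t ht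
    exact mul_div_cancel_right₀ _ ht
  have h := (tendsto_finsetSum _ hz).const_sub 1
  rw [Finset.sum_const_zero, sub_zero] at h
  refine h.congr fun t => ?_
  rw [sub_eq_iff_eq_add, Finset.add_sum_erase _ _ (Finset.mem_univ _)]
  exact (softmaxPolicy (θ (t + 1)) s).2.2.symm

lemma IsGNPG.infActionProb_pos [Nonempty S] (hθ : M.IsGNPG μ η θ) (hμ : ∀ s, 0 < μ.1 s)
    (hη : 0 < η) (hη' : 4 * η * (1 + (M.maxMismatch μ μ - (1 - M.γ)) / (1 - M.γ)) ≤ 1)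
    (hopt : M.IsOptimal (detPolicy b))
    (huniq : ∀ s a, a ≠ b s → M.qValue (detPolicy b) s a < M.qValue (detPolicy b) s (b s)) :
    0 < infActionProb b θ := by
  -- A sequence of positive numbers with limit one has bounded inverses, early iterates included;
  -- the sum of the bounds serves all states at once.
  have hbound : ∀ s, ∃ K, ∀ t, ((softmaxPolicy (θ (t + 1)) s).1 (b s))⁻¹ ≤ K := fun s => by
    obtain ⟨K, hK⟩ := ((hθ.tendsto_softmaxPolicy hμ hη hη' hopt huniq s).inv₀
      one_ne_zero).bddAbove_range
    exact ⟨K, fun t => hK ⟨t, rfl⟩⟩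
  choose K hK using hbound
  have hK0 : ∀ s, 0 < K s := fun s =>
    (inv_pos.2 (softmaxPolicy_pos (θ (0 + 1)) s (b s))).trans_le (hK s 0)
  refine (inv_pos.2 (Finset.sum_pos (fun s _ => hK0 s) Finset.univ_nonempty)).trans_le
    (le_csInf ?_ ?_)
  · obtain ⟨s⟩ := ‹Nonempty S›
    exact ⟨_, s, 1, le_rfl, rfl⟩
  · rintro _ ⟨s, t, ht, rfl⟩
    obtain ⟨t, rfl⟩ := Nat.exists_eq_add_of_le' ht
    rw [inv_le_comm₀ (Finset.sum_pos (fun s _ => hK0 s) Finset.univ_nonempty)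
      (softmaxPolicy_pos _ _ _)]
    exact (hK s t).trans (Finset.single_le_sum (fun s _ => (hK0 s).le) (Finset.mem_univ s))

end Convergence

/-! ### The linear rate -/

section Rate

variable {S A : Type*} [Fintype S] [Fintype A] [DecidableEq S] {M : FiniteMDP S A}
  {μ : stdSimplex ℝ S}

/-- Splits the rate into the ascent constant `η / 2` and the Łojasiewicz constant. One `√S` is
hidden in the step size and one comes from Cauchy–Schwarz over states; together they give `1 / S`.
-/
lemma rate_eq (π : Policy S A) (c : ℝ) :
    M.rate μ π c = M.stepSize μ / 2 * (c * (1 - M.γ)) / (√(Fintype.card S) * M.mismatch π μ μ) := by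
  have hS : (Fintype.card S : ℝ) = √(Fintype.card S) * √(Fintype.card S) :=
    (Real.mul_self_sqrt (Nat.cast_nonneg _)).symm
  have h2 : 12 * (1 - M.γ) + 16 * (M.maxMismatch μ μ - (1 - M.γ))
      = 2 * (6 * (1 - M.γ) + 8 * (M.maxMismatch μ μ - (1 - M.γ))) := by ring
  rw [rate, stepSize, h2]
  conv_lhs => rw [hS]
  simp only [div_eq_mul_inv, mul_inv, one_mul]
  ring

end Rate

section LinearRate

variable {S A : Type*} [Fintype A] [Nonempty A] {b : S → A} {θ : ℕ → EuclideanSpace ℝ (S × A)}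

lemma infActionProb_nonneg : 0 ≤ infActionProb b θ :=
  Real.sInf_nonneg (by rintro _ ⟨s, t, -, rfl⟩; exact (softmaxPolicy_pos _ _ _).le)

lemma infActionProb_le {t : ℕ} (ht : 1 ≤ t) (s : S) :
    infActionProb b θ ≤ (softmaxPolicy (θ t) s).1 (b s) :=
  csInf_le ⟨0, by rintro _ ⟨s, t, -, rfl⟩; exact (softmaxPolicy_pos _ _ _).le⟩ ⟨s, t, ht, rfl⟩

variable [Fintype S] [DecidableEq S] [DecidableEq A] {M : FiniteMDP S A} {μ : stdSimplex ℝ S}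

/-- Ascent and `lojasiewicz` multiply the gap by at most `1 - rate`, and `1 - x ≤ exp (-x)`. -/
lemma IsGNPG.valueAt_gap_succ_le [Nonempty S] (hθ : M.IsGNPG μ (M.stepSize μ) θ)
    (hμ : ∀ s, 0 < μ.1 s) (hopt : M.IsOptimal (detPolicy b)) {t : ℕ} (ht : 1 ≤ t) :
    M.valueAt (detPolicy b) μ - M.valueAt (softmaxPolicy (θ (t + 1))) μ
      ≤ Real.exp (-M.rate μ (detPolicy b) (infActionProb b θ))
        * (M.valueAt (detPolicy b) μ - M.valueAt (softmaxPolicy (θ t)) μ) := by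
  have hη : 0 < M.stepSize μ := M.stepSize_pos hμ
  have h1 := M.valueAt_normalized_step_ge (θ t) hμ hη.le (M.four_mul_stepSize_mul_le hμ)
  rw [← hθ t ht] at h1
  have h2 := lojasiewicz (M := M) hμ b (θ t) (fun s => infActionProb_le ht s) infActionProb_nonneg
  have hS : 0 < √(Fintype.card S : ℝ) := Real.sqrt_pos.2 (Nat.cast_pos.2 Fintype.card_pos)
  have hm : 0 < M.mismatch (detPolicy b) μ μ :=
    M.one_sub_γ_pos.trans_le (M.one_sub_γ_le_mismatch hμ _)
  set δ := M.valueAt (detPolicy b) μ - M.valueAt (softmaxPolicy (θ t)) μ with hδ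
  have h3 : M.rate μ (detPolicy b) (infActionProb b θ) * δ
      ≤ M.stepSize μ / 2 * ‖M.policyGradient μ (θ t)‖ := by
    rw [rate_eq, div_mul_eq_mul_div, div_le_iff₀ (mul_pos hS hm)]
    nlinarith [mul_le_mul_of_nonneg_left h2 (half_pos hη).le]
  have h4 := mul_le_mul_of_nonneg_right
    (Real.add_one_le_exp (-M.rate μ (detPolicy b) (infActionProb b θ)))
    (sub_nonneg.2 (hopt.valueAt_le (softmaxPolicy (θ t)) μ))
  rw [← hδ] at h4
  linarith

lemma IsGNPG.valueAt_gap_le [Nonempty S] (hθ : M.IsGNPG μ (M.stepSize μ) θ)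
    (hμ : ∀ s, 0 < μ.1 s) (hopt : M.IsOptimal (detPolicy b)) {t : ℕ} (ht : 1 ≤ t) :
    M.valueAt (detPolicy b) μ - M.valueAt (softmaxPolicy (θ t)) μ
      ≤ (M.valueAt (detPolicy b) μ - M.valueAt (softmaxPolicy (θ 1)) μ)
        * Real.exp (-(M.rate μ (detPolicy b) (infActionProb b θ) * ((t : ℝ) - 1))) := by
  induction t, ht using Nat.le_induction with
  | base => simp
  | succ t ht ih =>
    refine (hθ.valueAt_gap_succ_le hμ hopt ht).trans
      ((mul_le_mul_of_nonneg_left ih (Real.exp_pos _).le).trans_eq ?_)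
    rw [mul_left_comm, ← Real.exp_add]
    congr 2
    push_cast
    ring

end LinearRate

end FiniteMDP

theorem theorem3 {S A : Type*} [Fintype S] [Fintype A] [DecidableEq S] [DecidableEq A]
    [Nonempty A] (M : FiniteMDP S A) (μ ρ : stdSimplex ℝ S)
    (hμ : ∀ s, 0 < μ.1 s)
    (astar : S → A) (hopt : M.IsOptimal (FiniteMDP.detPolicy astar))
    (θ : ℕ → EuclideanSpace ℝ (S × A)) (hθ : M.IsGNPG μ (M.stepSize μ) θ) :
    -- if the optimal action is unique in every state, then the constant `c` is positive
    ((∀ s a, a ≠ astar s →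
        M.qValue (FiniteMDP.detPolicy astar) s a <
          M.qValue (FiniteMDP.detPolicy astar) s (astar s)) →
      0 < FiniteMDP.infActionProb astar θ) ∧
    -- the linear rate
    ∀ t : ℕ, 1 ≤ t →
      M.valueAt (FiniteMDP.detPolicy astar) ρ
          - M.valueAt (FiniteMDP.softmaxPolicy (θ t)) ρ ≤
        (M.valueAt (FiniteMDP.detPolicy astar) μ
            - M.valueAt (FiniteMDP.softmaxPolicy (θ 1)) μ)
          * M.maxMismatch ρ μ / (1 - M.γ)
          * Real.exp (-(M.rate μ (FiniteMDP.detPolicy astar)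
              (FiniteMDP.infActionProb astar θ) * ((t : ℝ) - 1))) := by
  obtain ⟨s₀⟩ : Nonempty S := by
    by_contra h
    rw [not_nonempty_iff] at h
    simpa using μ.2.2
  have : Nonempty S := ⟨s₀⟩
  refine ⟨hθ.infActionProb_pos hμ (M.stepSize_pos hμ) (M.four_mul_stepSize_mul_le hμ) hopt,
    fun t ht => (hopt.valueAt_gap_le hμ ρ _).trans ?_⟩
  rw [mul_div_assoc, mul_div_assoc, mul_right_comm]
  exact mul_le_mul_of_nonneg_right (hθ.valueAt_gap_le hμ hopt ht)
    (div_nonneg (FiniteMDP.maxMismatch_nonneg ρ μ) M.one_sub_γ_pos.le)
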